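/- Let $d\ge 1$ be an integer and let $|\cdot|$ denote the Euclidean norm on $\mathbb{R}^d$. For $\nu\ge 1/2$ and $\ell>0$ let $$C_{\nu,\ell}(x)=\frac{2^{1-\nu}}{\Gamma(\nu)}\Big(\sqrt{2\nu}\,\frac{|x|}{\ell}\Big)^{\nu}K_\nu\Big(\sqrt{2\nu}\,\frac{|x|}{\ell}\Big)\quad(x\in\mathbb{R}^d\setminus\{0\}),\qquad C_{\nu,\ell}(0)=1,$$ be the Matérn kernel, where $K_\nu$ is the modified Bessel function of the second kind. Write $\hat k(\xi)=\int_{\mathbb{R}^d}k(x)e^{-2\pi i\langle \xi,x\rangle}\,dx$ and $J_m=\{-m,-m+1,\dots,m\}^d$. Let $k=C_{\nu,\ell}$ with $\nu\ge 1/2$ and $0<\ell\le(\log 2)^{-1}\sqrt{\nu/(2d)}$, and let $0<h\le(1+\sqrt{8\nu}\,\ell)^{-1}$. Then $k$ is integrable and the following hold, all the series being absolutely convergent. (i) (Aliasing error.) For every $x\in[-1,1]^d$, $$\Bigg|\sum_{n\in\mathbb{Z}^d,\ n\ne 0}k\Big(x+\frac nh\Big)\Bigg|\le 4d\,3^{d-1}\cdot\frac{2^{1-\nu}}{\Gamma(\nu)}(4\nu)^\nu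 e^{2\nu}K_\nu(4\nu)\cdot e^{-\sqrt{\frac{\nu}{2d}}\,\frac{h^{-1}-1}{\ell}}.$$ (ii) (Truncation error.) For every integer $m\ge 1$ and every $x\in\mathbb{R}^d$, $$\Bigg|h^d\sum_{j\in\mathbb{Z}^d,\ j\notin J_m}\hat k(jh)\,e^{2\pi i h\langle j,x\rangle}\Bigg|\le\frac{\nu^{\nu-1}d\,5^{d-1}}{2^\nu\pi^{d/2+2\nu}}\,\frac{\Gamma(\nu+1/2)}{\Gamma(\nu)}\,\frac1{(h\ell m)^{2\nu}},$$ and the same bound also holds with $\Gamma(\nu+d/2)$ in place of $\Gamma(\nu+1/2)$. -/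

import Mathlib

open scoped FourierTransform

/-- The modified Bessel function of the second kind `K_ν(z)`, for real order `ν` and `z > 0`:
`K_ν(z) = ∫_0^∞ exp(-z cosh t) cosh(ν t) dt`. -/
noncomputable def besselK (ν z : ℝ) : ℝ :=
  ∫ t in Set.Ioi (0 : ℝ), Real.exp (-z * Real.cosh t) * Real.cosh (ν * t)

/-- The Matérn kernel `C_{ν,ℓ}` on `ℝ^d`. At the origin the formula is read as its limit `1`. -/
noncomputable def matern {d : ℕ} (ν ℓ : ℝ) (x : EuclideanSpace ℝ (Fin d)) : ℝ :=
  open Classical in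
  if x = 0 then 1
  else 2 ^ (1 - ν) / Real.Gamma ν * (Real.sqrt (2 * ν) * (‖x‖ / ℓ)) ^ ν
    * besselK ν (Real.sqrt (2 * ν) * (‖x‖ / ℓ))

/-- The Fourier transform `ξ ↦ ∫ C_{ν,ℓ}(x) exp(-2πi⟨ξ,x⟩) dx` of the Matérn kernel. -/
noncomputable def maternHat {d : ℕ} (ν ℓ : ℝ) : EuclideanSpace ℝ (Fin d) → ℂ :=
  𝓕 (fun x : EuclideanSpace ℝ (Fin d) => (matern ν ℓ x : ℂ))

/-- The integer multi-index `n ∈ ℤ^d` as a point of `ℝ^d`. -/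
def latticePoint {d : ℕ} (n : Fin d → ℤ) : EuclideanSpace ℝ (Fin d) :=
  WithLp.toLp 2 (fun i => (n i : ℝ))

/-- The index box `J_m = {-m, …, m}^d`. -/
def indexBox (d m : ℕ) : Set (Fin d → ℤ) :=
  {j | ∀ i, -(m : ℤ) ≤ j i ∧ j i ≤ (m : ℤ)}

/-- The term of index `n` of the aliasing sum, `C_{ν,ℓ}(x + n/h)`. -/
noncomputable def aliasTerm {d : ℕ} (ν ℓ h : ℝ) (x : EuclideanSpace ℝ (Fin d))
    (n : Fin d → ℤ) : ℝ :=
  matern ν ℓ (x + h⁻¹ • latticePoint n)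

/-- The term of index `j` of the truncation sum, `Ĉ_{ν,ℓ}(jh) exp(2πi h⟨j,x⟩)`. -/
noncomputable def truncTerm {d : ℕ} (ν ℓ h : ℝ) (x : EuclideanSpace ℝ (Fin d))
    (j : Fin d → ℤ) : ℂ :=
  maternHat ν ℓ (h • latticePoint j)
    * Complex.exp (2 * Real.pi * Complex.I * h * (inner ℝ (latticePoint j) x : ℝ))

open MeasureTheory Set
open scoped ENNReal

/-! ### The Matérn kernel as a mixture of Gaussians -/

/-! Everything rests on `matern_eq_integral`: the substitution `u = (z/2) e^t` in the Bessel
integral exhibits the kernel as a Gamma mixture of Gaussians. Fubini then gives integrability and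
the closed form `maternHat_eq`, a constant times `(1 + 2π²ℓ²|ξ|²/ν)^(-(ν+d/2))`.

Aliasing. Since `z^ν e^{z/2} K_ν(z)` decreases for `z ≥ 2ν`, the kernel is at most a constant times
`exp(-√(ν/2)|x|/ℓ)` once `|x| ≥ √(8ν) ℓ`, and the bound on `h` places every shifted point `x + n/h`,
`n ≠ 0`, in that region. By Cauchy–Schwarz `|x| ≥ ∑|x_i|/√d`, so the bound factors over coordinates
into geometric series, whose ratio is at most `1/2` by the bound on `ℓ`. A nonzero coordinate
contributes `4 e^{-λ(1/h-1)}` with `λ = √(ν/(2d))/ℓ`, each of the others at most `3`, and there are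
`d` choices of the nonzero one.

Truncation. Up to a constant, the terms have modulus `(A₀ + |j|²)^(-(ν+d/2))` with `A₀ =
ν/(2π²(ℓh)²)`. Outside the box some coordinate exceeds `m` in absolute value; the other `d-1` are
summed out one by one, each lowering the exponent by `1/2` at the cost of a factor `5
G(s-1/2)/G(s)`, which telescopes. `G = Γ` gives the bound with `Γ(ν+1/2)`, `G = 1` the one with
`Γ(ν+d/2)`. The remaining coordinate is compared with `∫_m^∞ y^(-2ν-1) dy`. -/

lemma integrableOn_rpow_mul_exp_neg_mul {a r : ℝ} (ha : 0 < a) (hr : 0 < r) :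
    IntegrableOn (fun t : ℝ => t ^ (a - 1) * Real.exp (-(r * t))) (Ioi 0) := by
  -- A non-integrable function has Bochner integral `0`, whereas the Gamma integral is positive.
  by_contra hcon
  have h0 := integral_undef hcon
  rw [Real.integral_rpow_mul_exp_neg_mul_Ioi ha hr] at h0
  have : 0 < (1 / r) ^ a * Real.Gamma a :=
    mul_pos (Real.rpow_pos_of_pos (by positivity) _) (Real.Gamma_pos_of_pos ha)
  exact this.ne' h0

lemma integrableOn_rpow_mul_exp_neg_sub_div {ν w : ℝ} (hν : 0 < ν) (hw : 0 ≤ w) :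
    IntegrableOn (fun t : ℝ => t ^ (ν - 1) * Real.exp (-t - w / t)) (Ioi 0) := by
  refine Integrable.mono' (integrableOn_rpow_mul_exp_neg_mul hν one_pos) ?_ ?_
  · exact (by fun_prop : Measurable fun t : ℝ => t ^ (ν - 1) * Real.exp (-t - w / t))
      |>.aestronglyMeasurable
  · filter_upwards [ae_restrict_mem measurableSet_Ioi] with t ht
    have ht : 0 < t := ht
    rw [Real.norm_of_nonneg (by positivity)]
    gcongr
    have : 0 ≤ w / t := by positivity
    linarith

lemma image_mul_exp_univ {c : ℝ} (hc : 0 < c) :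
    (fun t => c * Real.exp t) '' univ = Ioi (0 : ℝ) := by
  ext u
  constructor
  · rintro ⟨t, -, rfl⟩
    exact mul_pos hc (Real.exp_pos t)
  · intro hu
    have hu : 0 < u := hu
    refine ⟨Real.log (u / c), trivial, ?_⟩
    simp only
    rw [Real.exp_log (by positivity)]
    field_simp

/-- With `u = (z/2) e^t` one has `u + z²/(4u) = z cosh t`, and the Jacobian `u` raises `u^(ν-1)` to
`u^ν`. -/
lemma mul_exp_mul_integrand {ν z : ℝ} (hz : 0 < z) (t : ℝ) :
    |z / 2 * Real.exp t| • ((z / 2 * Real.exp t) ^ (ν - 1)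
      * Real.exp (-(z / 2 * Real.exp t) - z ^ 2 / 4 / (z / 2 * Real.exp t)))
      = (z / 2) ^ ν * (Real.exp (-z * Real.cosh t) * Real.exp (ν * t)) := by
  have hp : 0 < z / 2 * Real.exp t := by positivity
  have h1 : -(z / 2 * Real.exp t) - z ^ 2 / 4 / (z / 2 * Real.exp t) = -z * Real.cosh t := by
    rw [Real.cosh_eq, Real.exp_neg]
    field_simp
    ring
  rw [h1, abs_of_pos hp, smul_eq_mul, Real.rpow_sub_one hp.ne',
    Real.mul_rpow (by positivity) (by positivity), ← Real.exp_mul, mul_comm t ν]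
  field_simp

lemma integrable_exp_neg_mul_cosh_mul_exp {ν z : ℝ} (hν : 0 < ν) (hz : 0 < z) :
    Integrable (fun t => Real.exp (-z * Real.cosh t) * Real.exp (ν * t)) := by
  have h := (integrableOn_image_iff_integrableOn_abs_deriv_smul (s := univ)
    (f := fun t => z / 2 * Real.exp t) (f' := fun t => z / 2 * Real.exp t) MeasurableSet.univ
    (fun t _ => ((Real.hasDerivAt_exp t).const_mul (z / 2)).hasDerivWithinAt)
    (fun x _ y _ hxy => by simpa [hz.ne'] using hxy)
    (fun u => u ^ (ν - 1) * Real.exp (-u - z ^ 2 / 4 / u))).1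
  rw [image_mul_exp_univ (by positivity)] at h
  have h2 := h (integrableOn_rpow_mul_exp_neg_sub_div hν (by positivity))
  rw [integrableOn_univ] at h2
  simp_rw [mul_exp_mul_integrand hz] at h2
  have h3 := h2.const_mul ((z / 2) ^ ν)⁻¹
  refine h3.congr (Filter.Eventually.of_forall fun t => ?_)
  have : (z / 2) ^ ν ≠ 0 := (Real.rpow_pos_of_pos (by positivity) _).ne'
  field_simp

lemma integral_exp_neg_mul_cosh_mul_exp {ν z : ℝ} (hz : 0 < z) :
    ∫ u in Ioi (0 : ℝ), u ^ (ν - 1) * Real.exp (-u - z ^ 2 / 4 / u)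
      = (z / 2) ^ ν * ∫ t, Real.exp (-z * Real.cosh t) * Real.exp (ν * t) := by
  have h := integral_image_eq_integral_abs_deriv_smul (s := univ)
    (f := fun t => z / 2 * Real.exp t) (f' := fun t => z / 2 * Real.exp t) MeasurableSet.univ
    (fun t _ => ((Real.hasDerivAt_exp t).const_mul (z / 2)).hasDerivWithinAt)
    (fun x _ y _ hxy => by simpa [hz.ne'] using hxy)
    (fun u => u ^ (ν - 1) * Real.exp (-u - z ^ 2 / 4 / u))
  rw [image_mul_exp_univ (by positivity), Measure.restrict_univ] at h
  rw [h, ← integral_const_mul]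
  exact integral_congr_ae (Filter.Eventually.of_forall fun t => mul_exp_mul_integrand hz t)

lemma integrable_exp_neg_mul_cosh_mul_exp_neg {ν z : ℝ} (hν : 0 < ν) (hz : 0 < z) :
    Integrable (fun t => Real.exp (-z * Real.cosh t) * Real.exp (-(ν * t))) := by
  simpa using (integrable_exp_neg_mul_cosh_mul_exp hν hz).comp_neg

lemma integrable_exp_neg_mul_cosh_mul_cosh {ν z : ℝ} (hν : 0 < ν) (hz : 0 < z) :
    Integrable (fun t => Real.exp (-z * Real.cosh t) * Real.cosh (ν * t)) := by
  refine (((integrable_exp_neg_mul_cosh_mul_exp hν hz).add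
    (integrable_exp_neg_mul_cosh_mul_exp_neg hν hz)).div_const 2).congr
    (Filter.Eventually.of_forall fun t => ?_)
  simp only [Pi.add_apply, Real.cosh_eq (ν * t)]
  ring

/-- The integrand of `besselK` is even in `t`, and the two exponentials making up `cosh (ν t)` are
exchanged by `t ↦ -t`. -/
lemma two_mul_besselK {ν z : ℝ} (hν : 0 < ν) (hz : 0 < z) :
    2 * besselK ν z = ∫ t, Real.exp (-z * Real.cosh t) * Real.exp (ν * t) := by
  have h1 := integral_comp_abs (f := fun t => Real.exp (-z * Real.cosh t) * Real.cosh (ν * t))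
  have h2 : ∀ t : ℝ, Real.exp (-z * Real.cosh |t|) * Real.cosh (ν * |t|)
      = Real.exp (-z * Real.cosh t) * Real.exp (ν * t) / 2
        + Real.exp (-z * Real.cosh t) * Real.exp (-(ν * t)) / 2 := by
    intro t
    have : Real.cosh (ν * |t|) = Real.cosh (ν * t) := by
      rw [← Real.cosh_abs (ν * t), abs_mul, abs_of_pos hν]
    rw [this, Real.cosh_abs, Real.cosh_eq (ν * t)]
    ring
  simp_rw [h2] at h1
  rw [besselK, ← h1, integral_add ((integrable_exp_neg_mul_cosh_mul_exp hν hz).div_const 2)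
    ((integrable_exp_neg_mul_cosh_mul_exp_neg hν hz).div_const 2), integral_div, integral_div]
  have h3 := integral_neg_eq_self (fun t => Real.exp (-z * Real.cosh t) * Real.exp (ν * t)) volume
  simp only [Real.cosh_neg, mul_neg] at h3
  simp only [neg_mul] at h3 ⊢
  rw [h3]
  ring

/-- The Matérn kernel is a Gamma mixture of centred Gaussians. -/
lemma matern_eq_integral {d : ℕ} {ν ℓ : ℝ} (hν : 0 < ν) (hℓ : 0 < ℓ)
    (x : EuclideanSpace ℝ (Fin d)) :
    matern ν ℓ x = (Real.Gamma ν)⁻¹ * ∫ t in Ioi (0 : ℝ),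
      t ^ (ν - 1) * Real.exp (-t) * Real.exp (-(ν / (2 * ℓ ^ 2 * t)) * ‖x‖ ^ 2) := by
  have hG := Real.Gamma_pos_of_pos hν
  unfold matern
  split_ifs with hx
  · subst hx
    have : ∫ t in Ioi (0 : ℝ), t ^ (ν - 1) * Real.exp (-t)
        * Real.exp (-(ν / (2 * ℓ ^ 2 * t)) * ‖(0 : EuclideanSpace ℝ (Fin d))‖ ^ 2)
        = Real.Gamma ν := by
      have h := Real.integral_rpow_mul_exp_neg_mul_Ioi hν one_pos
      simpa using h
    rw [this]
    field_simp
  · have hx' : 0 < ‖x‖ := norm_pos_iff.2 hx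
    set z := Real.sqrt (2 * ν) * (‖x‖ / ℓ) with hz
    have hz0 : 0 < z := by positivity
    have hz2 : z ^ 2 = 2 * ν * (‖x‖ / ℓ) ^ 2 := by
      rw [hz, mul_pow, Real.sq_sqrt (by positivity)]
    have hint : ∫ t in Ioi (0 : ℝ),
        t ^ (ν - 1) * Real.exp (-t) * Real.exp (-(ν / (2 * ℓ ^ 2 * t)) * ‖x‖ ^ 2)
        = ∫ u in Ioi (0 : ℝ), u ^ (ν - 1) * Real.exp (-u - z ^ 2 / 4 / u) := by
      refine setIntegral_congr_fun measurableSet_Ioi fun t ht => ?_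
      have ht : 0 < t := ht
      rw [mul_assoc, ← Real.exp_add, hz2]
      congr 2
      field_simp
      ring
    rw [hint, integral_exp_neg_mul_cosh_mul_exp hz0, ← two_mul_besselK hν hz0,
      Real.div_rpow hz0.le (by norm_num), Real.rpow_sub (by norm_num), Real.rpow_one]
    have : (2 : ℝ) ^ ν ≠ 0 := (Real.rpow_pos_of_pos (by norm_num) _).ne'
    field_simp

/-! ### The Fourier transform of the Matérn kernel -/

/-- Tonelli: integrating out `x` first leaves a multiple of `t^(ν+d/2-1) e^{-t}`. This yields
integrability of the kernel and justifies Fubini for its Fourier transform. -/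
lemma integrable_gaussian_mixture {d : ℕ} {ν ℓ : ℝ} (hν : 0 < ν) (hℓ : 0 < ℓ) :
    Integrable (fun p : EuclideanSpace ℝ (Fin d) × ℝ =>
      p.2 ^ (ν - 1) * Real.exp (-p.2) * Real.exp (-(ν / (2 * ℓ ^ 2 * p.2)) * ‖p.1‖ ^ 2))
      (volume.prod (volume.restrict (Ioi 0))) := by
  have hm : Measurable (fun p : EuclideanSpace ℝ (Fin d) × ℝ =>
      p.2 ^ (ν - 1) * Real.exp (-p.2) * Real.exp (-(ν / (2 * ℓ ^ 2 * p.2)) * ‖p.1‖ ^ 2)) := by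
    fun_prop
  have hb : ∀ t : ℝ, 0 < t → 0 < ν / (2 * ℓ ^ 2 * t) := fun t ht => by positivity
  rw [integrable_prod_iff' hm.aestronglyMeasurable]
  constructor
  · filter_upwards [ae_restrict_mem measurableSet_Ioi] with t ht
    have := GaussianFourier.integrable_cexp_neg_mul_sq_norm_add (V := EuclideanSpace ℝ (Fin d))
      (b := (ν / (2 * ℓ ^ 2 * t) : ℝ)) (by rw [Complex.ofReal_re]; exact hb t ht) 0 0
    refine (this.norm.congr (Filter.Eventually.of_forall fun x => ?_)).const_mul _
    beta_reduce
    rw [show -((ν / (2 * ℓ ^ 2 * t) : ℝ) : ℂ) * ‖x‖ ^ 2 + 0 * (inner ℝ 0 x : ℝ)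
      = ((-(ν / (2 * ℓ ^ 2 * t)) * ‖x‖ ^ 2 : ℝ) : ℂ) by push_cast; ring, Complex.norm_exp,
      Complex.ofReal_re]
  · have hint := (integrableOn_rpow_mul_exp_neg_mul (a := ν + d / 2) (r := 1) (by positivity)
      one_pos).const_mul ((2 * Real.pi * ℓ ^ 2 / ν) ^ ((d : ℝ) / 2))
    refine hint.congr ?_
    filter_upwards [ae_restrict_mem measurableSet_Ioi] with t ht
    have ht' : 0 < t := ht
    have hnn : ∀ x : EuclideanSpace ℝ (Fin d), ‖t ^ (ν - 1) * Real.exp (-t)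
        * Real.exp (-(ν / (2 * ℓ ^ 2 * t)) * ‖x‖ ^ 2)‖ = t ^ (ν - 1) * Real.exp (-t)
        * Real.exp (-(ν / (2 * ℓ ^ 2 * t)) * ‖x‖ ^ 2) := fun x =>
      Real.norm_of_nonneg (by positivity)
    simp_rw [hnn]
    rw [integral_const_mul, GaussianFourier.integral_rexp_neg_mul_sq_norm (hb t ht')]
    have h1 : Real.pi / (ν / (2 * ℓ ^ 2 * t)) = (2 * Real.pi * ℓ ^ 2 / ν) * t := by field_simp
    rw [h1, finrank_euclideanSpace_fin, Real.mul_rpow (by positivity) ht'.le,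
      show ν + (d : ℝ) / 2 - 1 = (ν - 1) + d / 2 by ring, Real.rpow_add ht', one_mul]
    ring

lemma integrable_matern {d : ℕ} {ν ℓ : ℝ} (hν : 0 < ν) (hℓ : 0 < ℓ) :
    Integrable (fun x : EuclideanSpace ℝ (Fin d) => (matern ν ℓ x : ℂ)) := by
  simp_rw [matern_eq_integral hν hℓ]
  exact ((integrable_gaussian_mixture hν hℓ).integral_prod_left.const_mul _).ofReal

lemma maternHat_eq {d : ℕ} {ν ℓ : ℝ} (hν : 0 < ν) (hℓ : 0 < ℓ)
    (ξ : EuclideanSpace ℝ (Fin d)) :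
    maternHat ν ℓ ξ = ((Real.Gamma (ν + d / 2) / Real.Gamma ν
      * (2 * Real.pi * ℓ ^ 2 / ν) ^ ((d : ℝ) / 2)
      * (1 + 2 * Real.pi ^ 2 * ℓ ^ 2 / ν * ‖ξ‖ ^ 2) ^ (-(ν + d / 2)) : ℝ) : ℂ) := by
  have hint := (integrable_gaussian_mixture (d := d) hν hℓ).ofReal (𝕜 := ℂ)
  have hchar : Integrable (fun p : EuclideanSpace ℝ (Fin d) × ℝ =>
      Complex.exp (↑(-2 * Real.pi * inner ℝ p.1 ξ) * Complex.I) * ((p.2 ^ (ν - 1) * Real.exp (-p.2)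
        * Real.exp (-(ν / (2 * ℓ ^ 2 * p.2)) * ‖p.1‖ ^ 2) : ℝ) : ℂ))
      (volume.prod (volume.restrict (Ioi 0))) := by
    refine hint.bdd_mul (c := 1) (by fun_prop) (Filter.Eventually.of_forall fun p => ?_)
    rw [Complex.norm_exp_ofReal_mul_I]
  have hgauss : ∀ t : ℝ, 0 < t → ∫ x : EuclideanSpace ℝ (Fin d),
      Complex.exp (↑(-2 * Real.pi * inner ℝ x ξ) * Complex.I) * ((t ^ (ν - 1) * Real.exp (-t)
        * Real.exp (-(ν / (2 * ℓ ^ 2 * t)) * ‖x‖ ^ 2) : ℝ) : ℂ)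
      = (((2 * Real.pi * ℓ ^ 2 / ν) ^ ((d : ℝ) / 2) * (t ^ (ν + d / 2 - 1)
        * Real.exp (-((1 + 2 * Real.pi ^ 2 * ℓ ^ 2 / ν * ‖ξ‖ ^ 2) * t))) : ℝ) : ℂ) := by
    intro t ht
    have hb : 0 < ν / (2 * ℓ ^ 2 * t) := by positivity
    have h := fourier_gaussian_innerProductSpace (V := EuclideanSpace ℝ (Fin d))
      (b := (ν / (2 * ℓ ^ 2 * t) : ℝ)) (by rwa [Complex.ofReal_re]) ξ
    rw [Real.fourier_eq'] at h
    have h2 : ∀ x : EuclideanSpace ℝ (Fin d),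
      Complex.exp (↑(-2 * Real.pi * inner ℝ x ξ) * Complex.I) * ((t ^ (ν - 1) * Real.exp (-t)
        * Real.exp (-(ν / (2 * ℓ ^ 2 * t)) * ‖x‖ ^ 2) : ℝ) : ℂ)
      = ((t ^ (ν - 1) * Real.exp (-t) : ℝ) : ℂ) *
        (Complex.exp (↑(-2 * Real.pi * inner ℝ x ξ) * Complex.I)
          • Complex.exp (-((ν / (2 * ℓ ^ 2 * t) : ℝ) : ℂ) * ‖x‖ ^ 2)) := by
      intro x
      rw [smul_eq_mul]
      push_cast
      ring
    simp_rw [h2]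
    rw [integral_const_mul, h, finrank_euclideanSpace_fin]
    have h3 : (Real.pi / ((ν / (2 * ℓ ^ 2 * t) : ℝ) : ℂ)) ^ ((d : ℂ) / 2)
        = (((2 * Real.pi * ℓ ^ 2 / ν) ^ ((d : ℝ) / 2) * t ^ ((d : ℝ) / 2) : ℝ) : ℂ) := by
      rw [← Real.mul_rpow (by positivity) ht.le, Complex.ofReal_cpow (by positivity)]
      push_cast
      congr 1
      field_simp
    have h4 : Complex.exp (-Real.pi ^ 2 * ‖ξ‖ ^ 2 / ((ν / (2 * ℓ ^ 2 * t) : ℝ) : ℂ))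
        = ((Real.exp (-(2 * Real.pi ^ 2 * ℓ ^ 2 / ν * ‖ξ‖ ^ 2 * t)) : ℝ) : ℂ) := by
      rw [Complex.ofReal_exp]
      congr 1
      have : (ν : ℂ) ≠ 0 := by exact_mod_cast hν.ne'
      push_cast
      field_simp
    rw [h3, h4, ← Complex.ofReal_mul, ← Complex.ofReal_mul]
    congr 1
    rw [show ν + (d : ℝ) / 2 - 1 = (ν - 1) + d / 2 by ring, Real.rpow_add ht, add_mul, one_mul,
      neg_add, Real.exp_add]
    ring
  rw [maternHat, Real.fourier_eq']
  calc ∫ x : EuclideanSpace ℝ (Fin d),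
        Complex.exp (↑(-2 * Real.pi * inner ℝ x ξ) * Complex.I) • (matern ν ℓ x : ℂ)
      = ∫ x : EuclideanSpace ℝ (Fin d), ((Real.Gamma ν)⁻¹ : ℂ) * ∫ t in Ioi (0 : ℝ),
          Complex.exp (↑(-2 * Real.pi * inner ℝ x ξ) * Complex.I) * ((t ^ (ν - 1) * Real.exp (-t)
            * Real.exp (-(ν / (2 * ℓ ^ 2 * t)) * ‖x‖ ^ 2) : ℝ) : ℂ) := by
        congr 1
        ext x
        rw [matern_eq_integral hν hℓ, integral_const_mul, integral_complex_ofReal, smul_eq_mul]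
        push_cast
        ring
    _ = ((Real.Gamma ν)⁻¹ : ℂ) * ∫ t in Ioi (0 : ℝ), ∫ x : EuclideanSpace ℝ (Fin d),
          Complex.exp (↑(-2 * Real.pi * inner ℝ x ξ) * Complex.I) * ((t ^ (ν - 1) * Real.exp (-t)
            * Real.exp (-(ν / (2 * ℓ ^ 2 * t)) * ‖x‖ ^ 2) : ℝ) : ℂ) := by
        rw [integral_const_mul, integral_integral_swap hchar]
    _ = _ := by
        rw [setIntegral_congr_fun measurableSet_Ioi fun t ht => hgauss t ht,
          integral_complex_ofReal, integral_const_mul,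
          Real.integral_rpow_mul_exp_neg_mul_Ioi (by positivity) (by positivity), one_div,
          Real.inv_rpow (by positivity), ← Real.rpow_neg (by positivity)]
        push_cast
        ring

/-! ### Lattice sums -/

/-- Lattice sums are estimated in `ℝ≥0∞`, where rearrangement is free; this converts such an
estimate back into absolute convergence and a norm bound. -/
lemma summable_and_norm_tsum_le {ι E : Type*} [NormedAddCommGroup E] [CompleteSpace E]
    {f : ι → E} {B : ℝ} (hB : 0 ≤ B) (h : ∑' i, ENNReal.ofReal ‖f i‖ ≤ ENNReal.ofReal B) :
    Summable f ∧ ‖∑' i, f i‖ ≤ B := by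
  have hs : Summable fun i => ‖f i‖ := by
    have := ENNReal.summable_toReal (h.trans_lt ENNReal.ofReal_lt_top).ne
    simpa using this
  refine ⟨hs.of_norm, (norm_tsum_le_tsum_norm hs).trans ?_⟩
  rw [← ENNReal.ofReal_tsum_of_nonneg (fun _ => norm_nonneg _) hs] at h
  exact (ENNReal.ofReal_le_ofReal_iff hB).1 h

lemma tsum_pi_succ {n : ℕ} (i : Fin (n + 1)) (f : (Fin (n + 1) → ℤ) → ℝ≥0∞) :
    ∑' j, f j = ∑' r : ℤ, ∑' j : Fin n → ℤ, f (i.insertNth r j) := by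
  rw [← (Fin.insertNthEquiv (fun _ => ℤ) i).tsum_eq f, ENNReal.tsum_prod']
  rfl

/-- If every point of `S` has a coordinate satisfying `P`, a sum over `S` is at most the sum over
the coordinates `i` of the sums over the points whose `i`-th coordinate satisfies `P`. -/
lemma tsum_subtype_le_sum_insertNth {n : ℕ} {S : (Fin (n + 1) → ℤ) → Prop} {P : ℤ → Prop}
    (hS : ∀ j, S j → ∃ i, P (j i)) (f : (Fin (n + 1) → ℤ) → ℝ≥0∞) :
    ∑' j : {j // S j}, f j
      ≤ ∑ i : Fin (n + 1), ∑' r : {r // P r}, ∑' j : Fin n → ℤ, f (i.insertNth r.1 j) := by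
  classical
  have h1 : ∀ i : Fin (n + 1), ∑' r : {r // P r}, ∑' j : Fin n → ℤ, f (i.insertNth r.1 j)
      = ∑' j : Fin (n + 1) → ℤ, if P (j i) then f j else 0 := by
    intro i
    rw [tsum_pi_succ i]
    refine (tsum_subtype {r | P r} (fun r => ∑' j : Fin n → ℤ, f (i.insertNth r j))).trans
      (tsum_congr fun r => ?_)
    by_cases hr : P r <;> simp [indicator, hr]
  simp_rw [h1]
  rw [← Summable.tsum_finsetSum (fun _ _ => ENNReal.summable)]
  refine (tsum_subtype {j | S j} f).trans_le ?_
  refine ENNReal.tsum_le_tsum fun j => ?_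
  by_cases hj : S j
  · obtain ⟨i, hi⟩ := hS j hj
    calc indicator {j | S j} f j ≤ f j := indicator_le_self _ _ _
      _ = if P (j i) then f j else 0 := by rw [if_pos hi]
      _ ≤ _ := Finset.single_le_sum (f := fun i => if P (j i) then f j else 0)
        (fun _ _ => zero_le) (Finset.mem_univ i)
  · simp [indicator, hj]

lemma tsum_pi_prod {n : ℕ} (g : Fin n → ℤ → ℝ≥0∞) :
    ∑' j : Fin n → ℤ, ∏ i, g i (j i) = ∏ i, ∑' r, g i r := by
  induction n with
  | zero => simp
  | succ n ih =>
    rw [tsum_pi_succ 0, Fin.prod_univ_succ]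
    simp only [Fin.prod_univ_succ, Fin.insertNth_zero', Fin.cons_zero, Fin.cons_succ]
    simp_rw [ENNReal.tsum_mul_left, ih fun i => g i.succ, ENNReal.tsum_mul_right]

lemma tsum_int_ne_zero (f : ℤ → ℝ≥0∞) :
    ∑' r : {r : ℤ // r ≠ 0}, f r
      = ∑' n : ℕ, f ((n : ℤ) + 1) + ∑' n : ℕ, f (-((n : ℤ) + 1)) := by
  classical
  refine (tsum_subtype {r : ℤ | r ≠ 0} f).trans ?_
  rw [tsum_of_add_one_of_neg_add_one ENNReal.summable ENNReal.summable]
  have h1 : ∀ n : ℕ, (n : ℤ) + 1 ≠ 0 := fun n => by omega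
  have h2 : ∀ n : ℕ, -1 + -(n : ℤ) ≠ 0 := fun n => by omega
  simp [indicator, h1, h2]

lemma tsum_int_eq (f : ℤ → ℝ≥0∞) :
    ∑' r : ℤ, f r = f 0 + (∑' n : ℕ, f ((n : ℤ) + 1) + ∑' n : ℕ, f (-((n : ℤ) + 1))) := by
  rw [tsum_of_add_one_of_neg_add_one ENNReal.summable ENNReal.summable]
  ring

lemma tsum_geometric_ofReal {a q : ℝ} (ha : 0 ≤ a) (hq : 0 ≤ q) (hq1 : q < 1) :
    ∑' n : ℕ, ENNReal.ofReal (a * q ^ n) = ENNReal.ofReal (a / (1 - q)) := by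
  rw [← ENNReal.ofReal_tsum_of_nonneg (fun n => by positivity)
    ((summable_geometric_of_lt_one hq hq1).mul_left a), tsum_mul_left,
    tsum_geometric_of_lt_one hq hq1, div_eq_mul_inv]

/-! ### Aliasing sums of the exponential kernel -/

lemma exp_neg_mul_add_mul (lam x T : ℝ) (n : ℕ) :
    Real.exp (-(lam * (x + n * T))) = Real.exp (-(lam * x)) * Real.exp (-(lam * T)) ^ n := by
  rw [← Real.exp_nat_mul, ← Real.exp_add]
  congr 1
  ring

/-- The periodization of `exp (-λ|x|)` with `exp (-λT) ≤ 1/2` is at most `3`. -/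
lemma tsum_exp_neg_abs_le {lam T : ℝ} (hlam : 0 < lam) (hT : 0 < T)
    (hq : Real.exp (-(lam * T)) ≤ 1 / 2) (x : ℝ) :
    ∑' r : ℤ, ENNReal.ofReal (Real.exp (-(lam * |x + r * T|))) ≤ 3 := by
  set q := Real.exp (-(lam * T)) with hqdef
  have hq0 : 0 < q := Real.exp_pos _
  set k : ℤ := ⌊x / T⌋ with hk
  set y := x - k * T with hy
  have hy0 : 0 ≤ y := by
    have := Int.floor_le (x / T)
    rw [le_div_iff₀ hT] at this
    simpa [hy] using this
  have hyT : y ≤ T := by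
    have := (Int.lt_floor_add_one (x / T)).le
    rw [div_le_iff₀ hT] at this
    rw [hy]; linarith
  -- Shifting the index by `⌊x/T⌋` replaces `x` by `y ∈ [0, T]`; the two half-sums are then
  -- geometric, starting at distances `y` and `T - y` from the origin.
  rw [← (Equiv.subRight k).tsum_eq]
  have h0 : ∀ r : ℤ, x + ((Equiv.subRight k r : ℤ) : ℝ) * T = y + r * T := by
    intro r
    simp only [Equiv.subRight_apply, hy]
    push_cast
    ring
  simp_rw [h0]
  rw [tsum_of_nat_of_neg_add_one ENNReal.summable ENNReal.summable]
  have h1 : ∀ n : ℕ, Real.exp (-(lam * |y + ((n : ℤ) : ℝ) * T|))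
      = Real.exp (-(lam * y)) * q ^ n := by
    intro n
    rw [abs_of_nonneg (by push_cast; positivity), Int.cast_natCast, exp_neg_mul_add_mul]
  have h2 : ∀ n : ℕ, Real.exp (-(lam * |y + ((-((n : ℤ) + 1) : ℤ) : ℝ) * T|))
      = Real.exp (-(lam * (T - y))) * q ^ n := by
    intro n
    have : y + ((-((n : ℤ) + 1) : ℤ) : ℝ) * T = -((T - y) + n * T) := by push_cast; ring
    rw [this, abs_neg, abs_of_nonneg (add_nonneg (by linarith) (by positivity)),
      exp_neg_mul_add_mul]
  simp_rw [h1, h2]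
  rw [tsum_geometric_ofReal (by positivity) hq0.le (by linarith),
    tsum_geometric_ofReal (by positivity) hq0.le (by linarith),
    ← ENNReal.ofReal_add (div_nonneg (by positivity) (by linarith))
      (div_nonneg (by positivity) (by linarith)), ← add_div]
  refine ENNReal.ofReal_le_of_le_toReal ?_
  rw [ENNReal.toReal_ofNat, div_le_iff₀ (by linarith)]
  -- From `u, v ≤ 1` and `uv = q` follows `u + v ≤ 1 + q`, and `(1 + q)/(1 - q) ≤ 3` for `q ≤ 1/2`.
  set u := Real.exp (-(lam * y)) with hu
  set v := Real.exp (-(lam * (T - y))) with hv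
  have huv : u * v = q := by rw [hu, hv, hqdef, ← Real.exp_add]; congr 1; ring
  have hu1 : u ≤ 1 := Real.exp_le_one_iff.2 (by nlinarith)
  have hv1 : v ≤ 1 := Real.exp_le_one_iff.2 (by nlinarith)
  nlinarith [mul_nonneg (sub_nonneg.2 hu1) (sub_nonneg.2 hv1)]

/-- For `|x| ≤ 1` the points lie at distance at least `(T - 1) + (|r| - 1)T` from the origin, so
each sign of `r` gives a geometric series bounded by twice its first term. -/
lemma tsum_ne_zero_exp_neg_abs_le {lam T : ℝ} (hlam : 0 < lam)
    (hq : Real.exp (-(lam * T)) ≤ 1 / 2) {x : ℝ} (hx : x ∈ Icc (-1 : ℝ) 1) :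
    ∑' r : {r : ℤ // r ≠ 0}, ENNReal.ofReal (Real.exp (-(lam * |x + r * T|)))
      ≤ ENNReal.ofReal (4 * Real.exp (-(lam * (T - 1)))) := by
  set q := Real.exp (-(lam * T)) with hqdef
  have hq0 : 0 < q := Real.exp_pos _
  rw [tsum_int_ne_zero fun r => ENNReal.ofReal (Real.exp (-(lam * |x + r * T|)))]
  have hb : ∀ n : ℕ, ∀ y : ℝ, (T - 1) + n * T ≤ y → ENNReal.ofReal (Real.exp (-(lam * y)))
      ≤ ENNReal.ofReal (Real.exp (-(lam * (T - 1))) * q ^ n) := by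
    intro n y hy
    rw [← exp_neg_mul_add_mul]
    gcongr
  have hs : ∑' n : ℕ, ENNReal.ofReal (Real.exp (-(lam * (T - 1))) * q ^ n)
      ≤ ENNReal.ofReal (2 * Real.exp (-(lam * (T - 1)))) := by
    rw [tsum_geometric_ofReal (by positivity) hq0.le (by linarith)]
    refine ENNReal.ofReal_le_ofReal ?_
    rw [div_le_iff₀ (by linarith)]
    nlinarith [Real.exp_pos (-(lam * (T - 1)))]
  have h4 : ENNReal.ofReal (4 * Real.exp (-(lam * (T - 1))))
      = ENNReal.ofReal (2 * Real.exp (-(lam * (T - 1))))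
        + ENNReal.ofReal (2 * Real.exp (-(lam * (T - 1)))) := by
    rw [← ENNReal.ofReal_add (by positivity) (by positivity)]
    congr 1
    ring
  rw [h4]
  refine add_le_add (le_trans (ENNReal.tsum_le_tsum fun n => hb n _ ?_) hs)
    (le_trans (ENNReal.tsum_le_tsum fun n => hb n _ ?_) hs)
  · refine le_trans ?_ (le_abs_self _)
    push_cast
    linarith [hx.1]
  · refine le_trans ?_ (neg_le_abs _)
    push_cast
    linarith [hx.2]

lemma tsum_ne_zero_prod_exp_neg_abs_le {n : ℕ} {lam T : ℝ} (hlam : 0 < lam) (hT : 1 ≤ T)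
    (hq : Real.exp (-(lam * T)) ≤ 1 / 2) {x : Fin (n + 1) → ℝ} (hx : ∀ i, x i ∈ Icc (-1 : ℝ) 1) :
    ∑' j : {j : Fin (n + 1) → ℤ // j ≠ 0},
        ∏ i, ENNReal.ofReal (Real.exp (-(lam * |x i + j.1 i * T|)))
      ≤ ENNReal.ofReal ((n + 1) * (4 * Real.exp (-(lam * (T - 1))) * 3 ^ n)) := by
  refine (tsum_subtype_le_sum_insertNth (P := fun r => r ≠ 0) (fun j hj => Function.ne_iff.1 hj)
    (fun j => ∏ i, ENNReal.ofReal (Real.exp (-(lam * |x i + j i * T|))))).trans ?_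
  have h : ∀ i : Fin (n + 1), ∑' r : {r : ℤ // r ≠ 0}, ∑' j : Fin n → ℤ,
      ∏ k, ENNReal.ofReal
        (Real.exp (-(lam * |x k + ((i.insertNth r.1 j : Fin (n + 1) → ℤ) k : ℝ) * T|)))
      ≤ ENNReal.ofReal (4 * Real.exp (-(lam * (T - 1))) * 3 ^ n) := by
    intro i
    simp only [Fin.prod_univ_succAbove _ i, Fin.insertNth_apply_same,
      Fin.insertNth_apply_succAbove, ENNReal.tsum_mul_left]
    rw [tsum_pi_prod fun k r => ENNReal.ofReal (Real.exp (-(lam * |x (i.succAbove k) + r * T|))),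
      ENNReal.tsum_mul_right, ENNReal.ofReal_mul (by positivity)]
    refine mul_le_mul' (tsum_ne_zero_exp_neg_abs_le hlam hq (hx i)) ?_
    rw [ENNReal.ofReal_pow (by norm_num), ENNReal.ofReal_ofNat]
    refine (Finset.prod_le_pow_card _ _ 3 fun k _ =>
      tsum_exp_neg_abs_le hlam (by linarith) hq _).trans ?_
    simp
  refine (Finset.sum_le_sum fun i _ => h i).trans (le_of_eq ?_)
  rw [Finset.sum_const, Finset.card_univ, Fintype.card_fin, nsmul_eq_mul, ← Nat.cast_succ,
    ENNReal.ofReal_mul (Nat.cast_nonneg _), ENNReal.ofReal_natCast]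

/-! ### Decay of the Matérn kernel -/

lemma besselK_nonneg (ν z : ℝ) : 0 ≤ besselK ν z :=
  integral_nonneg fun _ => mul_nonneg (Real.exp_pos _).le (Real.cosh_pos _).le

/-- The function `z^ν e^{-z/2}` peaks at `z = 2ν`. Concretely, `z/w ≤ e^{z/w - 1}` is raised to the
power `ν`, and `ν/w ≤ 1/2`. -/
lemma rpow_mul_exp_neg_le {ν w z : ℝ} (hν : 0 < ν) (hw : 2 * ν ≤ w) (hz : w ≤ z) :
    z ^ ν * Real.exp (-(z / 2)) ≤ w ^ ν * Real.exp (-(w / 2)) := by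
  have hw0 : 0 < w := by linarith
  have h1 : z ^ ν ≤ w ^ ν * Real.exp ((z - w) / 2) := by
    have h2 : z / w ≤ Real.exp (z / w - 1) := by
      have := Real.add_one_le_exp (z / w - 1)
      linarith
    have h3 : (z / w) ^ ν ≤ Real.exp ((z - w) / 2) := by
      refine (Real.rpow_le_rpow (div_nonneg (by linarith) hw0.le) h2 hν.le).trans ?_
      rw [← Real.exp_mul, Real.exp_le_exp, show z / w - 1 = (z - w) / w by field_simp,
        div_mul_eq_mul_div, div_le_div_iff₀ hw0 (by norm_num)]
      nlinarith
    rw [Real.div_rpow (by linarith) hw0.le, div_le_iff₀ (Real.rpow_pos_of_pos hw0 _)] at h3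
    linarith
  calc z ^ ν * Real.exp (-(z / 2))
      ≤ w ^ ν * Real.exp ((z - w) / 2) * Real.exp (-(z / 2)) := by gcongr
    _ = w ^ ν * Real.exp (-(w / 2)) := by
      rw [mul_assoc, ← Real.exp_add]
      congr 2
      ring

/-- The function `z ^ ν * exp (z / 2) * K_ν(z)` is nonincreasing on `[2ν, ∞)`. -/
lemma rpow_mul_exp_mul_besselK_le {ν w z : ℝ} (hν : 0 < ν) (hw : 2 * ν ≤ w) (hz : w ≤ z) :
    z ^ ν * Real.exp (z / 2) * besselK ν z ≤ w ^ ν * Real.exp (w / 2) * besselK ν w := by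
  have hw0 : 0 < w := by linarith
  have hz0 : 0 < z := by linarith
  rw [besselK, besselK, ← integral_const_mul, ← integral_const_mul]
  refine integral_mono ((integrable_exp_neg_mul_cosh_mul_cosh hν hz0).integrableOn.const_mul _)
    ((integrable_exp_neg_mul_cosh_mul_cosh hν hw0).integrableOn.const_mul _) fun t => ?_
  -- Moving `e^{-y}` out of `e^{-y cosh t}` leaves `e^{-y(cosh t - 1)}`, so both factors are
  -- nonincreasing in `y` for every fixed `t`.
  have hsplit : ∀ y : ℝ, y ^ ν * Real.exp (y / 2) * (Real.exp (-y * Real.cosh t)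
      * Real.cosh (ν * t)) = y ^ ν * Real.exp (-(y / 2))
        * (Real.exp (-(y * (Real.cosh t - 1))) * Real.cosh (ν * t)) := by
    intro y
    have : Real.exp (y / 2) * Real.exp (-y * Real.cosh t)
        = Real.exp (-(y / 2)) * Real.exp (-(y * (Real.cosh t - 1))) := by
      rw [← Real.exp_add, ← Real.exp_add]
      congr 1
      ring
    linear_combination y ^ ν * Real.cosh (ν * t) * this
  simp only [hsplit]
  have hc : 0 ≤ Real.cosh t - 1 := by linarith [Real.one_le_cosh t]
  refine mul_le_mul (rpow_mul_exp_neg_le hν hw hz) ?_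
    (mul_nonneg (Real.exp_pos _).le (Real.cosh_pos _).le) (by positivity)
  refine mul_le_mul_of_nonneg_right ?_ (Real.cosh_pos _).le
  gcongr

lemma matern_nonneg {d : ℕ} {ν ℓ : ℝ} (hν : 0 < ν) (hℓ : 0 < ℓ) (x : EuclideanSpace ℝ (Fin d)) :
    0 ≤ matern ν ℓ x := by
  rw [matern_eq_integral hν hℓ]
  refine mul_nonneg (inv_nonneg.2 (Real.Gamma_pos_of_pos hν).le)
    (setIntegral_nonneg measurableSet_Ioi fun t ht => ?_)
  have : 0 < t := ht
  positivity

/-- The condition on `‖x‖` says `z ≥ 4ν`, as `4ν = √(2ν) √(8ν)`, and the exponential in the bound is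
`e^{-z/2}`, as `√(2ν) = 2 √(ν/2)`. -/
lemma matern_le_exp {d : ℕ} {ν ℓ : ℝ} (hν : 0 < ν) (hℓ : 0 < ℓ) {x : EuclideanSpace ℝ (Fin d)}
    (hx : Real.sqrt (8 * ν) * ℓ ≤ ‖x‖) :
    matern ν ℓ x ≤ 2 ^ (1 - ν) / Real.Gamma ν * (4 * ν) ^ ν * Real.exp (2 * ν)
      * besselK ν (4 * ν) * Real.exp (-(Real.sqrt (ν / 2) / ℓ * ‖x‖)) := by
  have hG := Real.Gamma_pos_of_pos hν
  have hx0 : 0 < ‖x‖ := lt_of_lt_of_le (by positivity) hx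
  rw [matern, if_neg (norm_pos_iff.1 hx0)]
  set z := Real.sqrt (2 * ν) * (‖x‖ / ℓ) with hz
  have hz4 : 4 * ν ≤ z := by
    have h1 : 4 * ν = Real.sqrt (2 * ν) * Real.sqrt (8 * ν) := by
      rw [← Real.sqrt_mul (by positivity), show 2 * ν * (8 * ν) = (4 * ν) ^ 2 by ring,
        Real.sqrt_sq (by positivity)]
    rw [h1, hz]
    gcongr
    rwa [le_div_iff₀ hℓ]
  have hz2 : Real.sqrt (ν / 2) / ℓ * ‖x‖ = z / 2 := by
    have : Real.sqrt (2 * ν) = 2 * Real.sqrt (ν / 2) := by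
      rw [show 2 * ν = 2 ^ 2 * (ν / 2) by ring, Real.sqrt_mul (by norm_num),
        Real.sqrt_sq (by norm_num)]
    rw [hz, this]
    ring
  have key := rpow_mul_exp_mul_besselK_le hν (w := 4 * ν) (z := z) (by linarith) hz4
  rw [show 4 * ν / 2 = 2 * ν by ring] at key
  rw [hz2]
  calc 2 ^ (1 - ν) / Real.Gamma ν * z ^ ν * besselK ν z
      = 2 ^ (1 - ν) / Real.Gamma ν * (z ^ ν * Real.exp (z / 2) * besselK ν z)
        * Real.exp (-(z / 2)) := by
        have : Real.exp (z / 2) * Real.exp (-(z / 2)) = 1 := by rw [← Real.exp_add]; simp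
        linear_combination -(2 ^ (1 - ν) / Real.Gamma ν * z ^ ν * besselK ν z) * this
    _ ≤ 2 ^ (1 - ν) / Real.Gamma ν * ((4 * ν) ^ ν * Real.exp (2 * ν) * besselK ν (4 * ν))
        * Real.exp (-(z / 2)) := by gcongr
    _ = _ := by ring

lemma sum_abs_le_sqrt_mul_norm {d : ℕ} (x : EuclideanSpace ℝ (Fin d)) :
    ∑ i, |x i| ≤ Real.sqrt d * ‖x‖ := by
  refine Real.le_sqrt_of_sq_le ?_ |>.trans_eq (b := Real.sqrt (d * ‖x‖ ^ 2)) ?_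
  · rw [EuclideanSpace.real_norm_sq_eq]
    have := sq_sum_le_card_mul_sum_sq (s := Finset.univ) (f := fun i => |x i|)
    simpa using this
  · rw [Real.sqrt_mul (by positivity), Real.sqrt_sq (norm_nonneg _)]

theorem aliasing_bound {n : ℕ} {ν ℓ h : ℝ} (hν : 0 < ν) (hℓ0 : 0 < ℓ)
    (hℓ : ℓ ≤ (Real.log 2)⁻¹ * Real.sqrt (ν / (2 * (n + 1 : ℕ))))
    (hh0 : 0 < h) (hh : h ≤ (1 + Real.sqrt (8 * ν) * ℓ)⁻¹)
    (x : EuclideanSpace ℝ (Fin (n + 1))) (hx : ∀ i, x i ∈ Icc (-1 : ℝ) 1) :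
    Summable (fun n : {j : Fin (n + 1) → ℤ // j ≠ 0} => aliasTerm ν ℓ h x n) ∧
      |∑' n : {j : Fin (n + 1) → ℤ // j ≠ 0}, aliasTerm ν ℓ h x n| ≤
        4 * (n + 1 : ℕ) * 3 ^ n
          * (2 ^ (1 - ν) / Real.Gamma ν * (4 * ν) ^ ν * Real.exp (2 * ν) * besselK ν (4 * ν))
          * Real.exp (-(Real.sqrt (ν / (2 * (n + 1 : ℕ))) * ((h⁻¹ - 1) / ℓ))) := by
  set T := h⁻¹ with hT
  set lam := Real.sqrt (ν / (2 * (n + 1 : ℕ))) / ℓ with hlam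
  set M := 2 ^ (1 - ν) / Real.Gamma ν * (4 * ν) ^ ν * Real.exp (2 * ν) * besselK ν (4 * ν) with hM
  have hM0 : 0 ≤ M := by
    have := besselK_nonneg ν (4 * ν)
    have := Real.Gamma_pos_of_pos hν
    positivity
  have hlam0 : 0 < lam := by positivity
  have hT1 : 1 + Real.sqrt (8 * ν) * ℓ ≤ T := by
    rw [hT]
    exact (le_inv_comm₀ hh0 (by positivity)).1 hh
  have hT1' : 1 ≤ T := le_trans (by linarith [show 0 ≤ Real.sqrt (8 * ν) * ℓ by positivity]) hT1
  have hlog : Real.log 2 ≤ lam := by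
    have h2 : 0 < Real.log 2 := Real.log_pos (by norm_num)
    rw [hlam, le_div_iff₀ hℓ0]
    calc Real.log 2 * ℓ ≤ Real.log 2 * ((Real.log 2)⁻¹ * Real.sqrt (ν / (2 * (n + 1 : ℕ)))) := by
          gcongr
      _ = _ := by field_simp
  have hq : Real.exp (-(lam * T)) ≤ 1 / 2 := by
    have : Real.exp (-Real.log 2) = 1 / 2 := by rw [Real.exp_neg, Real.exp_log] <;> norm_num
    rw [← this]
    gcongr
    nlinarith
  have hterm : ∀ j : Fin (n + 1) → ℤ, j ≠ 0 → aliasTerm ν ℓ h x j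
      ≤ M * ∏ i, Real.exp (-(lam * |x i + j i * T|)) := by
    intro j hj
    have hcoord : ∀ i, (x + T • latticePoint j) i = x i + j i * T := fun i => by
      simp [latticePoint, mul_comm]
    -- A nonzero coordinate `j i` gives `|x i + j i * T| ≥ T - 1 ≥ √(8ν) ℓ`.
    have hnorm : Real.sqrt (8 * ν) * ℓ ≤ ‖x + T • latticePoint j‖ := by
      obtain ⟨i, hi⟩ := Function.ne_iff.1 hj
      refine le_trans ?_ (PiLp.norm_apply_le (x + T • latticePoint j) i)
      rw [hcoord, Real.norm_eq_abs]
      have h1 : (1 : ℝ) ≤ |(j i : ℝ)| := by exact_mod_cast Int.one_le_abs hi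
      have h2 : |(j i : ℝ) * T| ≤ |x i + j i * T| + |x i| := by
        have := abs_sub (x i + j i * T) (x i)
        rwa [add_sub_cancel_left] at this
      rw [abs_mul, abs_of_pos (by linarith : 0 < T)] at h2
      have h3 : |x i| ≤ 1 := abs_le.2 (hx i)
      nlinarith
    rw [aliasTerm]
    refine (matern_le_exp hν hℓ0 hnorm).trans ?_
    rw [← Real.exp_sum]
    refine mul_le_mul_of_nonneg_left (Real.exp_le_exp.2 ?_) hM0
    rw [Finset.sum_neg_distrib, neg_le_neg_iff, ← Finset.mul_sum]
    -- Cauchy–Schwarz costs `√d`, which turns the rate `√(ν/2)/ℓ` into `lam`.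
    have h1 := sum_abs_le_sqrt_mul_norm (x + T • latticePoint j)
    simp_rw [hcoord] at h1
    calc lam * ∑ i, |x i + j i * T|
        ≤ lam * (Real.sqrt (n + 1 : ℕ) * ‖x + T • latticePoint j‖) := by gcongr
      _ = _ := by
        rw [hlam, show ν / (2 * ((n + 1 : ℕ) : ℝ)) = ν / 2 / (n + 1 : ℕ) by field_simp,
          Real.sqrt_div (by positivity)]
        have : Real.sqrt (n + 1 : ℕ) ≠ 0 := (Real.sqrt_pos.2 (by positivity)).ne'
        field_simp
  have hE := tsum_ne_zero_prod_exp_neg_abs_le hlam0 hT1' hq hx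
  have := summable_and_norm_tsum_le
    (f := fun n : {j : Fin (n + 1) → ℤ // j ≠ 0} => aliasTerm ν ℓ h x n)
    (B := M * ((n + 1) * (4 * Real.exp (-(lam * (T - 1))) * 3 ^ n))) (by positivity) ?_
  · refine ⟨this.1, this.2.trans (le_of_eq ?_)⟩
    rw [hlam, div_mul_eq_mul_div, mul_div_assoc]
    push_cast
    ring
  · rw [ENNReal.ofReal_mul hM0]
    refine le_trans ?_ (mul_le_mul_right hE _)
    rw [← ENNReal.tsum_mul_left]
    refine ENNReal.tsum_le_tsum fun j => ?_
    rw [← ENNReal.ofReal_prod_of_nonneg (fun _ _ => (Real.exp_pos _).le),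
      ← ENNReal.ofReal_mul hM0, aliasTerm, Real.norm_of_nonneg (matern_nonneg hν hℓ0 _)]
    exact ENNReal.ofReal_le_ofReal (hterm j.1 j.2)

/-! ### One-dimensional sums of inverse powers -/

lemma tsum_ofReal_le_integral {f : ℝ → ℝ} {a : ℝ} (hf : AntitoneOn f (Ici a))
    (hf0 : ∀ x ∈ Ioi a, 0 ≤ f x) (hint : IntegrableOn f (Ioi a)) :
    ∑' n : ℕ, ENNReal.ofReal (f (a + (n + 1 : ℕ))) ≤ ENNReal.ofReal (∫ x in Ioi a, f x) := by
  refine ENNReal.tsum_le_of_sum_range_le fun N => ?_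
  have hpos : ∀ n : ℕ, 0 ≤ f (a + (n + 1 : ℕ)) := fun n =>
    hf0 _ (by simp only [mem_Ioi]; push_cast; linarith [(Nat.cast_nonneg n : (0 : ℝ) ≤ n)])
  rw [← ENNReal.ofReal_sum_of_nonneg fun n _ => hpos n]
  refine ENNReal.ofReal_le_ofReal ?_
  refine (AntitoneOn.sum_le_integral (hf.mono Icc_subset_Ici_self)).trans ?_
  rw [intervalIntegral.integral_of_le (by simp)]
  exact setIntegral_mono_set hint ((ae_restrict_iff' measurableSet_Ioi).2
    (Filter.Eventually.of_forall hf0)) Ioc_subset_Ioi_self.eventuallyLE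

lemma tsum_gaussian_le {t : ℝ} (ht : 0 < t) :
    ∑' n : ℕ, ENNReal.ofReal (Real.exp (-t * ((n + 1 : ℕ) : ℝ) ^ 2))
      ≤ ENNReal.ofReal (Real.sqrt (Real.pi / t) / 2) := by
  have h := tsum_ofReal_le_integral (f := fun x => Real.exp (-t * x ^ 2)) (a := 0) ?_
    (fun _ _ => (Real.exp_pos _).le) (integrable_exp_neg_mul_sq ht).integrableOn
  · rw [integral_gaussian_Ioi] at h
    simpa only [zero_add] using h
  · intro x hx y _ hxy
    have hx : 0 ≤ x := hx
    simp only [neg_mul]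
    gcongr

lemma tsum_rpow_neg_le {ν : ℝ} (hν : 0 < ν) {m : ℕ} (hm : 1 ≤ m) :
    ∑' n : ℕ, ENNReal.ofReal (((m : ℝ) + (n + 1 : ℕ)) ^ (-(2 * ν + 1)))
      ≤ ENNReal.ofReal ((m : ℝ) ^ (-(2 * ν)) / (2 * ν)) := by
  have hm0 : (0 : ℝ) < m := by exact_mod_cast hm
  have h := tsum_ofReal_le_integral (f := fun x => x ^ (-(2 * ν + 1))) (a := m) ?_
    (fun x hx => (Real.rpow_pos_of_pos (hm0.trans hx) _).le)
    (integrableOn_Ioi_rpow_of_lt (by linarith) hm0)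
  · rw [integral_Ioi_rpow_of_lt (by linarith) hm0] at h
    convert h using 2
    rw [show -(2 * ν + 1) + 1 = -(2 * ν) by ring, neg_div_neg_eq]
  · intro x hx y _ hxy
    exact Real.rpow_le_rpow_of_nonpos (hm0.trans_le hx) hxy (by linarith)

lemma ofReal_rpow_neg_mul_Gamma {s B : ℝ} (hs : 0 < s) (hB : 0 < B) :
    ENNReal.ofReal (B ^ (-s)) * ENNReal.ofReal (Real.Gamma s)
      = ∫⁻ t in Ioi (0 : ℝ), ENNReal.ofReal (t ^ (s - 1) * Real.exp (-(B * t))) := by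
  rw [← ofReal_integral_eq_lintegral_ofReal (integrableOn_rpow_mul_exp_neg_mul hs hB),
    Real.integral_rpow_mul_exp_neg_mul_Ioi hs hB, ← ENNReal.ofReal_mul (by positivity), one_div,
    Real.inv_rpow hB.le, Real.rpow_neg hB.le]
  filter_upwards [ae_restrict_mem measurableSet_Ioi] with t ht
  have : 0 < t := ht
  positivity

/-- Writing each power as a Gamma integral turns the sum into a Gaussian one, at most `√(π/t)/2`;
the factor `t^(-1/2)` lowers the Gamma exponent from `s` to `s - 1/2`. -/
lemma tsum_nat_rpow_neg_le {s A : ℝ} (hs : 1 / 2 < s) (hA : 0 < A) :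
    ∑' n : ℕ, ENNReal.ofReal ((A + ((n + 1 : ℕ) : ℝ) ^ 2) ^ (-s))
      ≤ ENNReal.ofReal (Real.sqrt Real.pi / 2 * (Real.Gamma (s - 1 / 2) / Real.Gamma s)
        * A ^ (-(s - 1 / 2))) := by
  have hG := Real.Gamma_pos_of_pos (by linarith : 0 < s)
  have hG' := Real.Gamma_pos_of_pos (by linarith : 0 < s - 1 / 2)
  have hGe : ENNReal.ofReal (Real.Gamma s) ≠ 0 := by simpa using hG
  rw [← ENNReal.mul_le_mul_iff_left hGe ENNReal.ofReal_ne_top, ← ENNReal.tsum_mul_right]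
  simp_rw [fun n : ℕ => ofReal_rpow_neg_mul_Gamma (by linarith : 0 < s)
    (by positivity : 0 < A + ((n + 1 : ℕ) : ℝ) ^ 2)]
  rw [← lintegral_tsum fun n => by fun_prop]
  have hrhs : ENNReal.ofReal (Real.sqrt Real.pi / 2 * (Real.Gamma (s - 1 / 2) / Real.Gamma s)
        * A ^ (-(s - 1 / 2))) * ENNReal.ofReal (Real.Gamma s)
      = ENNReal.ofReal (Real.sqrt Real.pi / 2) * ∫⁻ t in Ioi (0 : ℝ),
        ENNReal.ofReal (t ^ (s - 1 / 2 - 1) * Real.exp (-(A * t))) := by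
    rw [← ofReal_rpow_neg_mul_Gamma (by linarith) hA, ← ENNReal.ofReal_mul (by positivity),
      ← ENNReal.ofReal_mul (by positivity), ← ENNReal.ofReal_mul (by positivity)]
    congr 1
    field_simp
  rw [hrhs, ← lintegral_const_mul' _ _ ENNReal.ofReal_ne_top]
  refine setLIntegral_mono' measurableSet_Ioi fun t ht => ?_
  have ht : 0 < t := ht
  have h1 : ∀ n : ℕ, ENNReal.ofReal (t ^ (s - 1) * Real.exp (-((A + ((n + 1 : ℕ) : ℝ) ^ 2) * t)))
      = ENNReal.ofReal (t ^ (s - 1) * Real.exp (-(A * t)))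
        * ENNReal.ofReal (Real.exp (-t * ((n + 1 : ℕ) : ℝ) ^ 2)) := by
    intro n
    rw [← ENNReal.ofReal_mul (by positivity), mul_assoc, ← Real.exp_add]
    congr 3
    ring
  simp_rw [h1]
  rw [ENNReal.tsum_mul_left]
  refine (mul_le_mul_right (tsum_gaussian_le ht) _).trans (le_of_eq ?_)
  rw [← ENNReal.ofReal_mul (by positivity), ← ENNReal.ofReal_mul (by positivity),
    Real.sqrt_div Real.pi_pos.le, show s - 1 / 2 - 1 = (s - 1) - 1 / 2 by ring,
    Real.rpow_sub ht (s - 1) (1 / 2), Real.sqrt_eq_rpow t]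
  congr 1
  ring

lemma tsum_int_rpow_neg_le {s A : ℝ} (hs : 1 / 2 < s) (hA : 0 < A) :
    ∑' r : ℤ, ENNReal.ofReal ((A + (r : ℝ) ^ 2) ^ (-s))
      ≤ ENNReal.ofReal (A ^ (-s) + Real.sqrt Real.pi * (Real.Gamma (s - 1 / 2) / Real.Gamma s)
        * A ^ (-(s - 1 / 2))) := by
  have hG := Real.Gamma_pos_of_pos (by linarith : 0 < s)
  have hG' := Real.Gamma_pos_of_pos (by linarith : 0 < s - 1 / 2)
  have h := tsum_nat_rpow_neg_le hs hA
  rw [tsum_int_eq]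
  have hsplit : ENNReal.ofReal (A ^ (-s) + Real.sqrt Real.pi
      * (Real.Gamma (s - 1 / 2) / Real.Gamma s) * A ^ (-(s - 1 / 2)))
      = ENNReal.ofReal (A ^ (-s)) + (ENNReal.ofReal (Real.sqrt Real.pi / 2
        * (Real.Gamma (s - 1 / 2) / Real.Gamma s) * A ^ (-(s - 1 / 2)))
        + ENNReal.ofReal (Real.sqrt Real.pi / 2
        * (Real.Gamma (s - 1 / 2) / Real.Gamma s) * A ^ (-(s - 1 / 2)))) := by
    rw [← ENNReal.ofReal_add (by positivity) (by positivity),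
      ← ENNReal.ofReal_add (by positivity) (by positivity)]
    congr 1
    ring
  rw [hsplit]
  push_cast at h ⊢
  refine add_le_add (by simp) (add_le_add h ?_)
  simp_rw [fun n : ℕ => neg_sq ((n : ℝ) + 1)]
  exact h

/-- Pulling out `A^(-(s-1))` reduces to exponent `1`, where the sum is at most `A⁻¹ + π A^(-1/2)`;
then `A ≥ 1` and `1 + π ≤ 5`. -/
lemma tsum_int_rpow_neg_le_five {s A : ℝ} (hs : 1 ≤ s) (hA : 1 ≤ A) :
    ∑' r : ℤ, ENNReal.ofReal ((A + (r : ℝ) ^ 2) ^ (-s))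
      ≤ ENNReal.ofReal (5 * A ^ (-(s - 1 / 2))) := by
  have hA0 : 0 < A := by linarith
  have h1 : ∀ r : ℤ, ENNReal.ofReal ((A + (r : ℝ) ^ 2) ^ (-s))
      ≤ ENNReal.ofReal (A ^ (-(s - 1))) * ENNReal.ofReal ((A + (r : ℝ) ^ 2) ^ (-(1 : ℝ))) := by
    intro r
    rw [← ENNReal.ofReal_mul (by positivity)]
    refine ENNReal.ofReal_le_ofReal ?_
    rw [show -s = -(s - 1) + -1 by ring, Real.rpow_add (by positivity)]
    refine mul_le_mul_of_nonneg_right ?_ (by positivity)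
    exact Real.rpow_le_rpow_of_nonpos hA0 (by nlinarith [sq_nonneg (r : ℝ)]) (by linarith)
  refine (ENNReal.tsum_le_tsum h1).trans ?_
  rw [ENNReal.tsum_mul_left]
  refine (mul_le_mul_right (tsum_int_rpow_neg_le (by norm_num) hA0) _).trans ?_
  rw [← ENNReal.ofReal_mul (by positivity)]
  refine ENNReal.ofReal_le_ofReal ?_
  rw [show (1 : ℝ) - 1 / 2 = 1 / 2 by norm_num, Real.Gamma_one_half_eq, Real.Gamma_one, div_one,
    Real.mul_self_sqrt Real.pi_pos.le]
  have h2 : A ^ (-(1 : ℝ)) ≤ A ^ (-(1 / 2) : ℝ) :=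
    Real.rpow_le_rpow_of_exponent_le hA (by norm_num)
  have h3 : A ^ (-(s - 1 / 2)) = A ^ (-(s - 1)) * A ^ (-(1 / 2) : ℝ) := by
    rw [← Real.rpow_add hA0]
    congr 1
    ring
  rw [h3, mul_left_comm]
  refine mul_le_mul_of_nonneg_left ?_ (by positivity)
  have := Real.pi_le_four
  have h4 : 0 < A ^ (-(1 / 2) : ℝ) := by positivity
  nlinarith

/-- Log-convexity of `Γ` at the midpoint of `s - 1/2` and `s + 1/2`. -/
lemma Gamma_le_sqrt_mul_Gamma_sub_half {s : ℝ} (hs : 1 / 2 < s) :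
    Real.Gamma s ≤ Real.sqrt (s - 1 / 2) * Real.Gamma (s - 1 / 2) := by
  have h0 : 0 < s - 1 / 2 := by linarith
  have hG := Real.Gamma_pos_of_pos h0
  have h := Real.Gamma_mul_add_mul_le_rpow_Gamma_mul_rpow_Gamma (s := s - 1 / 2)
    (t := s - 1 / 2 + 1) (a := 1 / 2) (b := 1 / 2) h0 (by linarith) (by norm_num) (by norm_num)
    (by norm_num)
  rw [Real.Gamma_add_one h0.ne', show 1 / 2 * (s - 1 / 2) + 1 / 2 * (s - 1 / 2 + 1) = s by ring,
    Real.mul_rpow h0.le hG.le, ← Real.sqrt_eq_rpow, ← Real.sqrt_eq_rpow] at h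
  refine h.trans (le_of_eq ?_)
  rw [mul_left_comm, Real.mul_self_sqrt hG.le]

/-- The Gaussian comparison uses `√π` of the constant `5`; the hypothesis lets the remaining `5 -
√π` absorb the central term `A^(-s)`. -/
lemma tsum_int_rpow_neg_le_five_mul_Gamma {s A : ℝ} (hs : 1 / 2 < s) (hA : 0 < A)
    (hsA : Real.sqrt (s - 1 / 2) ≤ (5 - Real.sqrt Real.pi) * Real.sqrt A) :
    ∑' r : ℤ, ENNReal.ofReal ((A + (r : ℝ) ^ 2) ^ (-s))
      ≤ ENNReal.ofReal (5 * (Real.Gamma (s - 1 / 2) / Real.Gamma s) * A ^ (-(s - 1 / 2))) := by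
  refine (tsum_int_rpow_neg_le hs hA).trans (ENNReal.ofReal_le_ofReal ?_)
  have hG := Real.Gamma_pos_of_pos (by linarith : 0 < s)
  have hG' := Real.Gamma_pos_of_pos (by linarith : 0 < s - 1 / 2)
  have h1 : A ^ (-(s - 1 / 2)) = A ^ (-s) * Real.sqrt A := by
    rw [Real.sqrt_eq_rpow, ← Real.rpow_add hA]
    congr 1
    ring
  have h2 : 1 ≤ (5 - Real.sqrt Real.pi) * (Real.Gamma (s - 1 / 2) / Real.Gamma s)
      * Real.sqrt A := by
    rw [mul_div_assoc', div_mul_eq_mul_div, le_div_iff₀ hG, one_mul]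
    refine (Gamma_le_sqrt_mul_Gamma_sub_half hs).trans ?_
    nlinarith
  rw [h1]
  have h3 : 0 < A ^ (-s) := by positivity
  nlinarith [mul_le_mul_of_nonneg_left h2 h3.le]

/-! ### Lattice sums of inverse powers -/

/-- Summing out the coordinates one at a time: if each one-dimensional sum costs a factor
`5 * G (s - 1/2) / G s`, then so does each coordinate of the lattice sum. -/
lemma tsum_lattice_rpow_neg_le {ν A₁ : ℝ} (hν : 0 < ν) (hA₁ : 0 < A₁) {G : ℝ → ℝ}
    (hG : ∀ s, 0 < s → 0 < G s) (n : ℕ)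
    (hstep : ∀ k < n, ∀ A, A₁ ≤ A →
      ∑' r : ℤ, ENNReal.ofReal ((A + (r : ℝ) ^ 2) ^ (-(ν + (k + 1 : ℝ) / 2 + 1 / 2)))
        ≤ ENNReal.ofReal (5 * (G (ν + (k + 1 : ℝ) / 2) / G (ν + (k + 1 : ℝ) / 2 + 1 / 2))
          * A ^ (-(ν + (k + 1 : ℝ) / 2)))) (A : ℝ) (hA : A₁ ≤ A) :
    ∑' j : Fin n → ℤ, ENNReal.ofReal ((A + ∑ i, (j i : ℝ) ^ 2) ^ (-(ν + (n + 1 : ℝ) / 2)))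
      ≤ ENNReal.ofReal (5 ^ n * (G (ν + 1 / 2) / G (ν + (n + 1 : ℝ) / 2))
        * A ^ (-(ν + 1 / 2))) := by
  have hA0 : 0 < A := hA₁.trans_le hA
  induction n with
  | zero =>
    have : G (ν + 1 / 2) ≠ 0 := (hG _ (by positivity)).ne'
    simp only [one_div] at this
    simp [this]
  | succ n ih =>
    have ih := ih fun k hk => hstep k (hk.trans (Nat.lt_succ_self n))
    have hg1 := hG (ν + (n + 1 : ℝ) / 2) (by positivity)
    have hg2 := hG (ν + (n + 1 : ℝ) / 2 + 1 / 2) (by positivity)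
    have hg3 := hG (ν + 1 / 2) (by positivity)
    -- The zeroth coordinate is summed innermost, with the squares of the others absorbed into `A`;
    -- this keeps the base at least `A₁`.
    rw [tsum_pi_succ 0, ENNReal.tsum_comm]
    have hexp : ν + (((n + 1 : ℕ) : ℝ) + 1) / 2 = ν + (n + 1 : ℝ) / 2 + 1 / 2 := by
      push_cast
      ring
    rw [hexp]
    have h1 : ∀ j : Fin n → ℤ, ∑' r : ℤ, ENNReal.ofReal ((A + ∑ i,
        ((Fin.insertNth 0 r j : Fin (n + 1) → ℤ) i : ℝ) ^ 2) ^ (-(ν + (n + 1 : ℝ) / 2 + 1 / 2)))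
        ≤ ENNReal.ofReal (5 * (G (ν + (n + 1 : ℝ) / 2) / G (ν + (n + 1 : ℝ) / 2 + 1 / 2)))
          * ENNReal.ofReal ((A + ∑ i, (j i : ℝ) ^ 2) ^ (-(ν + (n + 1 : ℝ) / 2))) := by
      intro j
      have hs : 0 ≤ ∑ i, (j i : ℝ) ^ 2 := Finset.sum_nonneg fun _ _ => sq_nonneg _
      rw [← ENNReal.ofReal_mul (by positivity)]
      refine le_trans (le_of_eq ?_) (hstep n (Nat.lt_succ_self n) (A + ∑ i, (j i : ℝ) ^ 2)
        (by linarith))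
      refine tsum_congr fun r => ?_
      simp only [Fin.sum_univ_succ, Fin.insertNth_zero', Fin.cons_zero, Fin.cons_succ]
      congr 2
      ring
    refine (ENNReal.tsum_le_tsum h1).trans ?_
    rw [ENNReal.tsum_mul_left]
    refine (mul_le_mul_right ih _).trans (le_of_eq ?_)
    rw [← ENNReal.ofReal_mul (by positivity)]
    congr 1
    rw [pow_succ]
    generalize G (ν + (n + 1 : ℝ) / 2) = a at hg1
    generalize G (ν + (n + 1 : ℝ) / 2 + 1 / 2) = b at hg2
    field_simp

lemma tsum_int_abs_gt_le {ν A : ℝ} (hν : 0 < ν) (hA : 0 ≤ A) {m : ℕ} (hm : 1 ≤ m) :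
    ∑' r : {r : ℤ // (m : ℤ) < |r|}, ENNReal.ofReal ((A + (r : ℝ) ^ 2) ^ (-(ν + 1 / 2)))
      ≤ ENNReal.ofReal ((m : ℝ) ^ (-(2 * ν)) / ν) := by
  classical
  set g : ℝ → ℝ≥0∞ := fun y => ENNReal.ofReal ((A + y ^ 2) ^ (-(ν + 1 / 2))) with hg
  have hm0 : (0 : ℝ) < m := by exact_mod_cast hm
  have hterm : ∀ n : ℕ, g (m + (n + 1 : ℕ))
      ≤ ENNReal.ofReal (((m : ℝ) + (n + 1 : ℕ)) ^ (-(2 * ν + 1))) := by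
    intro n
    have hp : 0 < (m : ℝ) + (n + 1 : ℕ) := by positivity
    refine ENNReal.ofReal_le_ofReal ?_
    rw [show -(2 * ν + 1) = 2 * -(ν + 1 / 2) by ring, Real.rpow_mul hp.le, Real.rpow_two]
    exact Real.rpow_le_rpow_of_nonpos (by positivity) (by linarith) (by linarith)
  have hhalf : ∑' n : ℕ, (if m < n + 1 then g ((n : ℝ) + 1) else 0)
      ≤ ENNReal.ofReal ((m : ℝ) ^ (-(2 * ν)) / (2 * ν)) := by
    -- The first `m` terms, belonging to `|r| = 1, …, m`, vanish.
    rw [← ENNReal.summable.sum_add_tsum_nat_add' (k := m), Finset.sum_eq_zero, zero_add]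
    · refine le_trans (ENNReal.tsum_le_tsum fun n => ?_) (tsum_rpow_neg_le hν hm)
      rw [if_pos (by omega)]
      refine le_trans (le_of_eq ?_) (hterm n)
      push_cast
      congr 1
      ring
    · intro i hi
      rw [if_neg (by have := Finset.mem_range.1 hi; omega)]
  have hneg : ∀ y, g (-y) = g y := fun y => by simp [hg]
  refine (tsum_subtype {r : ℤ | (m : ℤ) < |r|} fun r : ℤ => g r).trans_le ?_
  rw [tsum_int_eq]
  have e0 : indicator {r : ℤ | (m : ℤ) < |r|} (fun r : ℤ => g r) 0 = 0 := by simp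
  have e1 : ∀ n : ℕ, indicator {r : ℤ | (m : ℤ) < |r|} (fun r : ℤ => g r) ((n : ℤ) + 1)
      = if m < n + 1 then g ((n : ℝ) + 1) else 0 := by
    intro n
    have : |(n : ℤ) + 1| = n + 1 := abs_of_nonneg (by positivity)
    simp only [indicator, mem_ofPred_eq, this]
    push_cast
    congr 1
    exact propext (by omega)
  have e2 : ∀ n : ℕ, indicator {r : ℤ | (m : ℤ) < |r|} (fun r : ℤ => g r) (-((n : ℤ) + 1))
      = if m < n + 1 then g ((n : ℝ) + 1) else 0 := by
    intro n
    rw [← e1 n]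
    simp only [indicator, mem_ofPred_eq, abs_neg, Int.cast_neg, hneg]
  simp_rw [e0, e1, e2]
  rw [zero_add]
  refine (add_le_add hhalf hhalf).trans (le_of_eq ?_)
  rw [← ENNReal.ofReal_add (by positivity) (by positivity)]
  congr 1
  field_simp
  ring

/-- The distinguished coordinate satisfies `r² ≥ 1`, so the other coordinates are summed with base
at least `A₀ + 1`; hence the range of `A` in `hstep`. -/
lemma tsum_notMem_indexBox_le {ν A₀ : ℝ} (hν : 0 < ν) (hA₀ : 0 < A₀) {G : ℝ → ℝ}
    (hG : ∀ s, 0 < s → 0 < G s) (n : ℕ)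
    (hstep : ∀ k < n, ∀ A, A₀ + 1 ≤ A →
      ∑' r : ℤ, ENNReal.ofReal ((A + (r : ℝ) ^ 2) ^ (-(ν + (k + 1 : ℝ) / 2 + 1 / 2)))
        ≤ ENNReal.ofReal (5 * (G (ν + (k + 1 : ℝ) / 2) / G (ν + (k + 1 : ℝ) / 2 + 1 / 2))
          * A ^ (-(ν + (k + 1 : ℝ) / 2)))) {m : ℕ} (hm : 1 ≤ m) :
    ∑' j : {j : Fin (n + 1) → ℤ // j ∉ indexBox (n + 1) m},
        ENNReal.ofReal ((A₀ + ∑ i, (j.1 i : ℝ) ^ 2) ^ (-(ν + (n + 1 : ℝ) / 2)))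
      ≤ ENNReal.ofReal ((n + 1) * (5 ^ n * (G (ν + 1 / 2) / G (ν + (n + 1 : ℝ) / 2))
        * ((m : ℝ) ^ (-(2 * ν)) / ν))) := by
  have hg1 := hG (ν + (n + 1 : ℝ) / 2) (by positivity)
  have hg3 := hG (ν + 1 / 2) (by positivity)
  refine (tsum_subtype_le_sum_insertNth (P := fun r => (m : ℤ) < |r|) (fun j hj => ?_)
    (fun j => ENNReal.ofReal ((A₀ + ∑ i, (j i : ℝ) ^ 2) ^ (-(ν + (n + 1 : ℝ) / 2))))).trans ?_
  · by_contra! hcon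
    exact hj fun i => abs_le.1 (hcon i)
  have h : ∀ i : Fin (n + 1), ∑' r : {r : ℤ // (m : ℤ) < |r|}, ∑' j : Fin n → ℤ,
      ENNReal.ofReal ((A₀ + ∑ k, ((i.insertNth r.1 j : Fin (n + 1) → ℤ) k : ℝ) ^ 2)
        ^ (-(ν + (n + 1 : ℝ) / 2)))
      ≤ ENNReal.ofReal (5 ^ n * (G (ν + 1 / 2) / G (ν + (n + 1 : ℝ) / 2))
        * ((m : ℝ) ^ (-(2 * ν)) / ν)) := by
    intro i
    simp only [Fin.sum_univ_succAbove _ i, Fin.insertNth_apply_same,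
      Fin.insertNth_apply_succAbove, ← add_assoc]
    rw [ENNReal.ofReal_mul (by positivity)]
    refine le_trans (ENNReal.tsum_le_tsum fun r => tsum_lattice_rpow_neg_le hν
      (by positivity : 0 < A₀ + 1) hG n hstep (A₀ + (r.1 : ℝ) ^ 2) ?_) ?_
    · have h1 : (1 : ℝ) ≤ |(r.1 : ℝ)| := by
        have : (1 : ℤ) ≤ |r.1| := by have := r.2; omega
        exact_mod_cast this
      have h2 : (1 : ℝ) ≤ (r.1 : ℝ) ^ 2 := by
        rw [← sq_abs]
        nlinarith
      linarith
    · simp_rw [fun r : {r : ℤ // (m : ℤ) < |r|} => ENNReal.ofReal_mul (q := (A₀ + (r.1 : ℝ) ^ 2)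
        ^ (-(ν + 1 / 2))) (by positivity :
          0 ≤ 5 ^ n * (G (ν + 1 / 2) / G (ν + (n + 1 : ℝ) / 2)))]
      rw [ENNReal.tsum_mul_left]
      exact mul_le_mul_right (tsum_int_abs_gt_le hν hA₀.le hm) _
  refine (Finset.sum_le_sum fun i _ => h i).trans (le_of_eq ?_)
  rw [Finset.sum_const, Finset.card_univ, Fintype.card_fin, nsmul_eq_mul, ← Nat.cast_succ,
    ENNReal.ofReal_mul (Nat.cast_nonneg _), ENNReal.ofReal_natCast]

/-! ### Truncation of the Fourier series -/

lemma norm_latticePoint_sq {d : ℕ} (j : Fin d → ℤ) :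
    ‖latticePoint j‖ ^ 2 = ∑ i, (j i : ℝ) ^ 2 := by
  rw [EuclideanSpace.real_norm_sq_eq]
  rfl

/-- Factor `c = 2π²(ℓh)²/ν` out of `1 + c|j|²`: of the resulting `c^(-ν) c^(-d/2)`, the second power
cancels against `h^d (2πℓ²/ν)^(d/2)` and leaves `π^(-d/2)`. -/
lemma pow_mul_norm_truncTerm {d : ℕ} {ν ℓ h : ℝ} (hν : 0 < ν) (hℓ : 0 < ℓ) (hh : 0 < h)
    (x : EuclideanSpace ℝ (Fin d)) (j : Fin d → ℤ) :
    h ^ d * ‖truncTerm ν ℓ h x j‖ = Real.Gamma (ν + (d : ℝ) / 2) / Real.Gamma ν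
      * Real.pi ^ (-((d : ℝ) / 2)) * (ν / (2 * Real.pi ^ 2 * (ℓ * h) ^ 2)) ^ ν
      * (ν / (2 * Real.pi ^ 2 * (ℓ * h) ^ 2) + ∑ i, (j i : ℝ) ^ 2) ^ (-(ν + (d : ℝ) / 2)) := by
  have hG := Real.Gamma_pos_of_pos hν
  have hG' := Real.Gamma_pos_of_pos (by positivity : 0 < ν + (d : ℝ) / 2)
  have hexp : ‖Complex.exp (2 * Real.pi * Complex.I * h * (inner ℝ (latticePoint j) x : ℝ))‖
      = 1 := by
    rw [show (2 * Real.pi * Complex.I * h * (inner ℝ (latticePoint j) x : ℝ) : ℂ)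
      = ((2 * Real.pi * h * inner ℝ (latticePoint j) x : ℝ) : ℂ) * Complex.I by push_cast; ring,
      Complex.norm_exp_ofReal_mul_I]
  rw [truncTerm, norm_mul, hexp, mul_one, maternHat_eq hν hℓ, Complex.norm_real,
    Real.norm_of_nonneg (by positivity), norm_smul, mul_pow, norm_latticePoint_sq,
    Real.norm_eq_abs, sq_abs]
  set S := ∑ i, (j i : ℝ) ^ 2 with hS
  have hS0 : 0 ≤ S := Finset.sum_nonneg fun _ _ => sq_nonneg _
  set c := 2 * Real.pi ^ 2 * (ℓ * h) ^ 2 / ν with hc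
  have hc0 : 0 < c := by positivity
  have hA : ν / (2 * Real.pi ^ 2 * (ℓ * h) ^ 2) = c⁻¹ := by rw [hc, inv_div]
  have h1 : 1 + 2 * Real.pi ^ 2 * ℓ ^ 2 / ν * (h ^ 2 * S) = c * (c⁻¹ + S) := by
    rw [mul_add, mul_inv_cancel₀ hc0.ne', hc]
    ring
  have h2 : (2 * Real.pi * ℓ ^ 2 / ν) ^ ((d : ℝ) / 2) * h ^ d
      = Real.pi ^ (-((d : ℝ) / 2)) * c ^ ((d : ℝ) / 2) := by
    have hhd : h ^ d = (h ^ 2) ^ ((d : ℝ) / 2) := by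
      rw [← Real.rpow_natCast, ← Real.rpow_two, ← Real.rpow_mul hh.le]
      congr 1
      ring
    rw [hhd, Real.rpow_neg Real.pi_pos.le, ← Real.inv_rpow Real.pi_pos.le,
      ← Real.mul_rpow (by positivity) (by positivity),
      ← Real.mul_rpow (by positivity) (by positivity), hc]
    congr 1
    field_simp
  rw [hA, h1, Real.mul_rpow hc0.le (by positivity), neg_add, Real.rpow_add hc0,
    Real.inv_rpow hc0.le, ← Real.rpow_neg hc0.le]
  have h3 : c ^ ((d : ℝ) / 2) * c ^ (-((d : ℝ) / 2)) = 1 := by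
    rw [← Real.rpow_add hc0]
    simp
  linear_combination (Real.Gamma (ν + (d : ℝ) / 2) / Real.Gamma ν * c ^ (-ν)
    * c ^ (-((d : ℝ) / 2)) * (c⁻¹ + S) ^ (-ν + -((d : ℝ) / 2))) * h2
    + (Real.Gamma (ν + (d : ℝ) / 2) / Real.Gamma ν * Real.pi ^ (-((d : ℝ) / 2)) * c ^ (-ν)
    * (c⁻¹ + S) ^ (-ν + -((d : ℝ) / 2))) * h3

lemma truncation_bound_of_step {n : ℕ} {ν ℓ h : ℝ} (hν : 0 < ν) (hℓ : 0 < ℓ) (hh : 0 < h)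
    {G : ℝ → ℝ} (hG : ∀ s, 0 < s → 0 < G s)
    (hstep : ∀ k < n, ∀ A, ν / (2 * Real.pi ^ 2 * (ℓ * h) ^ 2) + 1 ≤ A →
      ∑' r : ℤ, ENNReal.ofReal ((A + (r : ℝ) ^ 2) ^ (-(ν + (k + 1 : ℝ) / 2 + 1 / 2)))
        ≤ ENNReal.ofReal (5 * (G (ν + (k + 1 : ℝ) / 2) / G (ν + (k + 1 : ℝ) / 2 + 1 / 2))
          * A ^ (-(ν + (k + 1 : ℝ) / 2)))) {m : ℕ} (hm : 1 ≤ m)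
    (x : EuclideanSpace ℝ (Fin (n + 1))) :
    Summable (fun j : {j : Fin (n + 1) → ℤ // j ∉ indexBox (n + 1) m} => truncTerm ν ℓ h x j) ∧
      ‖(h : ℂ) ^ (n + 1) * ∑' j : {j : Fin (n + 1) → ℤ // j ∉ indexBox (n + 1) m},
        truncTerm ν ℓ h x j‖ ≤
        ν ^ (ν - 1) * (n + 1 : ℕ) * 5 ^ n
            / (2 ^ ν * Real.pi ^ (((n + 1 : ℕ) : ℝ) / 2 + 2 * ν))
          * (Real.Gamma (ν + ((n + 1 : ℕ) : ℝ) / 2)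
            * (G (ν + 1 / 2) / G (ν + ((n + 1 : ℕ) : ℝ) / 2)) / Real.Gamma ν)
          * (1 / (h * ℓ * m) ^ (2 * ν)) := by
  have hm0 : (0 : ℝ) < m := by exact_mod_cast hm
  set A₀ := ν / (2 * Real.pi ^ 2 * (ℓ * h) ^ 2) with hA₀
  have hA₀0 : 0 < A₀ := by positivity
  have hGν := Real.Gamma_pos_of_pos hν
  have hGd := Real.Gamma_pos_of_pos (by positivity : 0 < ν + ((n + 1 : ℕ) : ℝ) / 2)
  have hg1 := hG (ν + (n + 1 : ℝ) / 2) (by positivity)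
  have hg3 := hG (ν + 1 / 2) (by positivity)
  set K := Real.Gamma (ν + ((n + 1 : ℕ) : ℝ) / 2) / Real.Gamma ν
    * Real.pi ^ (-(((n + 1 : ℕ) : ℝ) / 2)) * A₀ ^ ν with hK
  have hK0 : 0 ≤ K := by positivity
  have hh' : (h : ℂ) ^ (n + 1) ≠ 0 := pow_ne_zero _ (by exact_mod_cast hh.ne')
  have hsum := summable_and_norm_tsum_le
    (f := fun j : {j : Fin (n + 1) → ℤ // j ∉ indexBox (n + 1) m} =>
      (h : ℂ) ^ (n + 1) * truncTerm ν ℓ h x j)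
    (B := K * ((n + 1) * (5 ^ n * (G (ν + 1 / 2) / G (ν + (n + 1 : ℝ) / 2))
        * ((m : ℝ) ^ (-(2 * ν)) / ν)))) (by positivity) ?_
  · rw [tsum_mul_left] at hsum
    refine ⟨(summable_mul_left_iff hh').1 hsum.1, hsum.2.trans (le_of_eq ?_)⟩
    have hA : A₀ ^ ν = ν ^ ν / (2 ^ ν * Real.pi ^ (2 * ν) * (h * ℓ) ^ (2 * ν)) := by
      rw [hA₀, Real.div_rpow hν.le (by positivity), Real.mul_rpow (by positivity) (by positivity),
        Real.mul_rpow (by positivity) (by positivity), Real.rpow_mul Real.pi_pos.le,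
        Real.rpow_mul (by positivity : 0 ≤ h * ℓ), Real.rpow_two, Real.rpow_two, mul_comm ℓ h]
    rw [hK, hA, Real.rpow_neg Real.pi_pos.le, Real.rpow_neg hm0.le,
      Real.mul_rpow (by positivity : 0 ≤ h * ℓ) hm0.le, Real.rpow_add Real.pi_pos,
      Real.rpow_sub_one hν.ne']
    push_cast
    generalize G (ν + (n + 1 : ℝ) / 2) = a at hg1
    generalize G (ν + 1 / 2) = b at hg3
    field_simp
  · rw [ENNReal.ofReal_mul hK0]
    refine le_trans (le_of_eq ?_)
      (mul_le_mul_right (tsum_notMem_indexBox_le hν hA₀0 hG n hstep hm) _)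
    rw [← ENNReal.tsum_mul_left]
    refine tsum_congr fun j => ?_
    rw [← ENNReal.ofReal_mul hK0, norm_mul, norm_pow, Complex.norm_real,
      Real.norm_of_nonneg hh.le, pow_mul_norm_truncTerm hν hℓ hh, hK,
      hA₀]
    push_cast
    rfl

/-- This supplies the size condition of `tsum_int_rpow_neg_le_five_mul_Gamma` for all exponents at
once: there `s - 1/2` never exceeds `ν + d/2`, and `A ≥ A₀`. -/
lemma add_half_dim_le {d : ℕ} (hd : 1 ≤ d) {ν ℓ h : ℝ} (hν : 1 / 2 ≤ ν) (hℓ0 : 0 < ℓ)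
    (hℓ : ℓ ≤ (Real.log 2)⁻¹ * Real.sqrt (ν / (2 * d)))
    (hh0 : 0 < h) (hh : h ≤ (1 + Real.sqrt (8 * ν) * ℓ)⁻¹) :
    ν + (d : ℝ) / 2 ≤ 10.4 * (ν / (2 * Real.pi ^ 2 * (ℓ * h) ^ 2)) := by
  have hd0 : (0 : ℝ) < d := by exact_mod_cast hd
  have hν0 : 0 < ν := by linarith
  have hlog : 0.6931 < Real.log 2 := by linarith [Real.log_two_gt_d9]
  have hpi : Real.pi ^ 2 < 9.87 := by nlinarith [Real.pi_lt_d4, Real.pi_pos]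
  -- `(ℓ h)⁻² ≥ ℓ⁻² + 8ν ≥ 2 d (log 2)² / ν + 8ν`
  have h1 : ℓ⁻¹ + Real.sqrt (8 * ν) ≤ (ℓ * h)⁻¹ := by
    have := (le_inv_comm₀ hh0 (by positivity)).1 hh
    calc ℓ⁻¹ + Real.sqrt (8 * ν) = ℓ⁻¹ * (1 + Real.sqrt (8 * ν) * ℓ) := by field_simp
      _ ≤ ℓ⁻¹ * h⁻¹ := by gcongr
      _ = _ := by rw [mul_inv]
  have h2 : ℓ⁻¹ ^ 2 + 8 * ν ≤ (ℓ * h)⁻¹ ^ 2 := by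
    have h3 := pow_le_pow_left₀ (by positivity) h1 2
    have h4 : 0 ≤ ℓ⁻¹ * Real.sqrt (8 * ν) := by positivity
    have h5 := Real.sq_sqrt (by positivity : 0 ≤ 8 * ν)
    nlinarith
  have h3 : Real.log 2 ^ 2 * (2 * d) ≤ ν * ℓ⁻¹ ^ 2 := by
    have h4 : Real.log 2 * ℓ ≤ Real.sqrt (ν / (2 * d)) := by
      have := mul_le_mul_of_nonneg_left hℓ (by linarith : 0 ≤ Real.log 2)
      rwa [mul_inv_cancel_left₀ (by linarith)] at this
    have h5 := pow_le_pow_left₀ (by positivity) h4 2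
    rw [Real.sq_sqrt (by positivity), le_div_iff₀ (by positivity)] at h5
    rw [inv_pow, ← div_eq_mul_inv, le_div_iff₀ (by positivity)]
    linarith
  have h4 : ν / (2 * Real.pi ^ 2 * (ℓ * h) ^ 2) = ν * (ℓ * h)⁻¹ ^ 2 / (2 * Real.pi ^ 2) := by
    field_simp
  rw [h4, mul_div_assoc', le_div_iff₀ (by positivity)]
  have h5 : Real.log 2 ^ 2 * (2 * d) + 8 * ν ^ 2 ≤ ν * (ℓ * h)⁻¹ ^ 2 := by nlinarith
  have h6 : 0.4803 ≤ Real.log 2 ^ 2 := by nlinarith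
  have h7 : 0.9606 * d ≤ Real.log 2 ^ 2 * (2 * d) := by nlinarith
  have h8 : (ν + (d : ℝ) / 2) * (2 * Real.pi ^ 2) ≤ (ν + (d : ℝ) / 2) * 19.74 := by
    gcongr
    linarith
  -- The `d` terms compare by `9.87 ≤ 10.4 * 0.9606`, the `ν` terms by `19.74 ν ≤ 83.2 ν²`, where `ν
  -- ≥ 1/2` enters.
  nlinarith

/-- The constant `10.4` is just below `3.225²`, where `3.225 = 5 - 1.775 ≤ 5 - √π`. -/
lemma sqrt_le_five_sub_sqrt_pi_mul_sqrt {s A : ℝ} (h : s ≤ 10.4 * A) :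
    Real.sqrt s ≤ (5 - Real.sqrt Real.pi) * Real.sqrt A := by
  have hpi : Real.sqrt Real.pi ≤ 1.775 :=
    Real.sqrt_le_iff.2 ⟨by norm_num, by nlinarith [Real.pi_lt_d4]⟩
  calc Real.sqrt s ≤ Real.sqrt (3.225 ^ 2 * A) := by
        by_cases hA : 0 ≤ A
        · exact Real.sqrt_le_sqrt (by nlinarith)
        · rw [Real.sqrt_eq_zero_of_nonpos (by linarith)]
          positivity
    _ = 3.225 * Real.sqrt A := by
        rw [Real.sqrt_mul (by norm_num), Real.sqrt_sq (by norm_num)]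
    _ ≤ _ := by
        gcongr
        linarith

theorem theorem4p4 (d : ℕ) (hd : 1 ≤ d) (ν ℓ h : ℝ) (hν : 1 / 2 ≤ ν)
    (hℓ0 : 0 < ℓ) (hℓ : ℓ ≤ (Real.log 2)⁻¹ * Real.sqrt (ν / (2 * d)))
    (hh0 : 0 < h) (hh : h ≤ (1 + Real.sqrt (8 * ν) * ℓ)⁻¹) :
    -- aliasing error, uniformly on `[-1,1]^d`
    (∀ x : EuclideanSpace ℝ (Fin d), (∀ i, x i ∈ Set.Icc (-1 : ℝ) 1) →
      Summable (fun n : {n : Fin d → ℤ // n ≠ 0} => aliasTerm ν ℓ h x n) ∧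
      |∑' n : {n : Fin d → ℤ // n ≠ 0}, aliasTerm ν ℓ h x n| ≤
        4 * d * 3 ^ (d - 1)
          * (2 ^ (1 - ν) / Real.Gamma ν * (4 * ν) ^ ν * Real.exp (2 * ν) * besselK ν (4 * ν))
          * Real.exp (-(Real.sqrt (ν / (2 * d)) * ((h⁻¹ - 1) / ℓ)))) ∧
    -- the Fourier transform of the kernel is an absolutely convergent integral
    MeasureTheory.Integrable
      (fun x : EuclideanSpace ℝ (Fin d) => (matern ν ℓ x : ℂ)) ∧
    -- truncation error, uniformly on `ℝ^d`
    (∀ m : ℕ, 1 ≤ m → ∀ x : EuclideanSpace ℝ (Fin d),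
      Summable (fun j : {j : Fin d → ℤ // j ∉ indexBox d m} => truncTerm ν ℓ h x j) ∧
      ‖(h : ℂ) ^ d * ∑' j : {j : Fin d → ℤ // j ∉ indexBox d m}, truncTerm ν ℓ h x j‖ ≤
        ν ^ (ν - 1) * d * 5 ^ (d - 1) / (2 ^ ν * Real.pi ^ ((d : ℝ) / 2 + 2 * ν))
          * (Real.Gamma (ν + 1 / 2) / Real.Gamma ν)
          * (1 / (h * ℓ * m) ^ (2 * ν)) ∧
      ‖(h : ℂ) ^ d * ∑' j : {j : Fin d → ℤ // j ∉ indexBox d m}, truncTerm ν ℓ h x j‖ ≤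
        ν ^ (ν - 1) * d * 5 ^ (d - 1) / (2 ^ ν * Real.pi ^ ((d : ℝ) / 2 + 2 * ν))
          * (Real.Gamma (ν + (d : ℝ) / 2) / Real.Gamma ν)
          * (1 / (h * ℓ * m) ^ (2 * ν))) := by
  have hν0 : 0 < ν := by linarith
  have hnum := add_half_dim_le hd hν hℓ0 hℓ hh0 hh
  obtain ⟨n, rfl⟩ : ∃ n, d = n + 1 := ⟨d - 1, by omega⟩
  rw [Nat.add_sub_cancel]
  have hA₀ : 0 < ν / (2 * Real.pi ^ 2 * (ℓ * h) ^ 2) := by positivity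
  refine ⟨fun x hx => aliasing_bound hν0 hℓ0 hℓ hh0 hh x hx, integrable_matern hν0 hℓ0,
    fun m hm x => ?_⟩
  -- With `G = Γ` the telescoped quotient cancels `Γ(ν+d/2)` from the Fourier transform and leaves
  -- `Γ(ν+1/2)`.
  have hΓ := truncation_bound_of_step (n := n) hν0 hℓ0 hh0 (G := Real.Gamma)
    (fun s hs => Real.Gamma_pos_of_pos hs) (fun k hk A hA => by
      have hk' : (k : ℝ) + 1 ≤ n := by exact_mod_cast hk
      have := tsum_int_rpow_neg_le_five_mul_Gamma (s := ν + (k + 1 : ℝ) / 2 + 1 / 2) (A := A)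
        (by have : (0 : ℝ) ≤ k := Nat.cast_nonneg k
            linarith) (by linarith)
        (sqrt_le_five_sub_sqrt_pi_mul_sqrt (by push_cast at hnum; linarith))
      rwa [add_sub_cancel_right] at this) hm x
  -- With `G = 1` nothing cancels and `Γ(ν+d/2)` survives; the base is at least `A₀ + 1 ≥ 1`, as the
  -- cruder one-dimensional bound requires.
  have h1 := truncation_bound_of_step (n := n) hν0 hℓ0 hh0 (G := fun _ => 1)
    (fun _ _ => one_pos) (fun k _ A hA => by
      have := tsum_int_rpow_neg_le_five (s := ν + (k + 1 : ℝ) / 2 + 1 / 2) (A := A)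
        (by have : (0 : ℝ) ≤ k := Nat.cast_nonneg k
            linarith) (by linarith)
      simpa only [add_sub_cancel_right, div_one, mul_one] using this) hm x
  have hGd := Real.Gamma_pos_of_pos (by positivity : 0 < ν + ((n + 1 : ℕ) : ℝ) / 2)
  rw [mul_div_cancel₀ _ hGd.ne'] at hΓ
  rw [div_one, mul_one] at h1
  exact ⟨hΓ.1, hΓ.2, h1.2⟩
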